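/- For elements $a,b$ of a group write $[a,b]=a^{-1}b^{-1}ab$, and put $[a,{}_0b]=a$ and $[a,{}_{n}b]=[[a,{}_{n-1}b],b]$ for $n\ge 1$. An element $x$ of a group $G$ is called right $4$-Engel if $[x,{}_4g]=1$ for all $g\in G$, and $G$ is called a $4$-Engel group if all its elements are right $4$-Engel. Let $G$ be a nilpotent group generated by two elements, one of which is a right $4$-Engel element of $G$. If $G$ has no element of order $2$, $3$ or $5$, then $G$ is a $4$-Engel group, and $G$ is nilpotent of class at most $6$. -/

import Mathlib

namespace EngelGroup

/-- The group commutator with the convention `[a, b] = a⁻¹ b⁻¹ a b`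
(Mathlib's `⁅a, b⁆` is `a b a⁻¹ b⁻¹`). -/
def comm {G : Type*} [Group G] (a b : G) : G := a⁻¹ * b⁻¹ * a * b

/-- The left-normed Engel commutator `[a, ₙ b]`: `[a, ₀ b] = a` and
`[a, ₙ₊₁ b] = [[a, ₙ b], b]`. -/
def engelComm {G : Type*} [Group G] (a b : G) : ℕ → G
  | 0 => a
  | n + 1 => comm (engelComm a b n) b

/-- `x` is a right `n`-Engel element: `[x, ₙ g] = 1` for every `g` in the group. -/
def IsRightEngel {G : Type*} [Group G] (n : ℕ) (x : G) : Prop :=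
  ∀ g : G, engelComm x g n = 1

/-- A group is `n`-Engel if all its elements are right `n`-Engel. -/
def IsEngel (n : ℕ) (G : Type*) [Group G] : Prop :=
  ∀ x : G, IsRightEngel n x

end EngelGroup

/-! Let F be the free group of rank two mapped onto G, and write γ_n for the lower central series
(`gam`). Since [γ_5, γ_5] ≤ γ_10, the quotient γ_5/γ_8 of F is abelian; it is generated by 6 + 9 +
18 = 33 left-normed commutators (`gam_five_le_spn_basis`). The Magnus coefficients at the 33 Lyndon
words of lengths 5, 6 and 7 are additive on γ_5 and vanish on γ_8. On the 33 commutators they form a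
matrix invertible over ℤ, so they are coordinates on γ_5/γ_8 (`mem_gam_eight_of_cvec_eq_zero`).

Let R be a normal subgroup containing all [a, ₄g]. The coordinates of thirty conjugates of such
commutators span, over ℚ, the common kernel of the three functionals in `Balanced`. A matrix inverse
with denominators cleared by 1800 turns this into: if w in γ_5 is balanced, then w^1800 lies in Rγ_8
(`exists_mem_pow_mul_inv_mem`).

Two kinds of elements are balanced: those of γ_7, because the functionals only involve words of
length 5 and 6, and all [x, ₄g] with x, g arbitrary in F, by a polynomial identity in the
coefficients of x and g of degree at most two (`balanced_engelComm`). Now take for R the kernel of F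
→ G. The first kind shows that 1800 annihilates γ_7/γ_8 in G, hence every later factor; as 1800 =
2³·3²·5² and G is nilpotent without elements of order 2, 3, 5, γ_7(G) is trivial
(`gam_eq_bot_of_pow_mem`). The second kind then gives [x, ₄g]^1800 = 1 in G, so [x, ₄g] = 1. -/

open scoped commutatorElement

/-! ### The Magnus representation by left multiplications, and its degree filtration -/

namespace MagnusRep

/-- Formal series in two noncommuting variables with integer coefficients. -/
abbrev Series := List Bool → ℤ

/-- Left multiplication by `1 + x`. -/
def letterFun (x : Bool) (v : Series) : Series
  | [] => v []
  | y :: u => v (y :: u) + if y = x then v u else 0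

/-- Left multiplication by `(1 + x)⁻¹`. -/
def letterInv (x : Bool) (v : Series) : Series
  | [] => v []
  | y :: u => v (y :: u) - if y = x then letterInv x v u else 0

def letter (x : Bool) : Series ≃ₗ[ℤ] Series where
  toFun := letterFun x
  invFun := letterInv x
  map_add' v w := by
    funext u
    cases u with
    | nil => rfl
    | cons y u => simp only [letterFun, Pi.add_apply]; split_ifs <;> ring
  map_smul' c v := by
    funext u
    cases u with
    | nil => rfl
    | cons y u => simp only [letterFun, Pi.smul_apply, smul_eq_mul, RingHom.id_apply]; split_ifs <;> ring
  left_inv v := by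
    funext u
    induction u with
    | nil => rfl
    | cons y u ih =>
      simp only [letterInv, letterFun, ih]
      split_ifs <;> ring
  right_inv v := by
    funext u
    cases u with
    | nil => rfl
    | cons y u =>
      simp only [letterInv, letterFun]
      split_ifs <;> ring

/-- The Magnus representation of the free group of rank two. -/
noncomputable def magnus : FreeGroup Bool →* (Series ≃ₗ[ℤ] Series) := FreeGroup.lift letter

@[simp] lemma magnus_of (x : Bool) : magnus (FreeGroup.of x) = letter x := by simp [magnus]

lemma magnus_mul_apply (w z : FreeGroup Bool) (v : Series) :
    magnus (w * z) v = magnus w (magnus z v) := by rw [map_mul]; rfl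

lemma magnus_inv_cancel (w : FreeGroup Bool) (v : Series) : magnus w (magnus w⁻¹ v) = v := by
  rw [← magnus_mul_apply, mul_inv_cancel, map_one]; rfl

/-- `v` has no terms of degree less than `k`. -/
def Vanish (k : ℕ) (v : Series) : Prop := ∀ u : List Bool, u.length < k → v u = 0

lemma Vanish.add {k : ℕ} {v w : Series} (hv : Vanish k v) (hw : Vanish k w) : Vanish k (v + w) :=
  fun u hu => by simp [hv u hu, hw u hu]

lemma Vanish.sub {k : ℕ} {v w : Series} (hv : Vanish k v) (hw : Vanish k w) : Vanish k (v - w) :=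
  fun u hu => by simp [hv u hu, hw u hu]

lemma Vanish.neg {k : ℕ} {v : Series} (hv : Vanish k v) : Vanish k (-v) :=
  fun u hu => by simp [hv u hu]

lemma Vanish.mono {k l : ℕ} {v : Series} (hv : Vanish k v) (h : l ≤ k) : Vanish l v :=
  fun u hu => hv u (hu.trans_le h)

lemma Vanish.letter {k : ℕ} {v : Series} (hv : Vanish k v) (x : Bool) :
    Vanish (k + 1) (letter x v - v) := by
  intro u hu
  cases u with
  | nil => show letterFun x v [] - v [] = 0; simp [letterFun]
  | cons y u =>
    show letterFun x v (y :: u) - v (y :: u) = 0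
    have := hv u (by simpa using hu)
    simp [letterFun, this]

lemma Vanish.letter_symm {k : ℕ} {v : Series} (hv : Vanish k v) (x : Bool) :
    Vanish k ((MagnusRep.letter x).symm v) := by
  intro u
  show u.length < k → letterInv x v u = 0
  induction u with
  | nil => exact fun hu => hv _ hu
  | cons y u ih =>
    intro hu
    have h1 := hv _ hu
    have h2 := ih (by simp at hu; omega)
    simp [letterInv, h1, h2]

lemma Vanish.magnus {k : ℕ} {v : Series} (hv : Vanish k v) (w : FreeGroup Bool) :
    Vanish k (magnus w v) := by
  induction w using FreeGroup.induction_on generalizing v with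
  | C1 => simpa using hv
  | of x =>
    rw [magnus_of]
    simpa using ((hv.letter x).mono (Nat.le_succ k)).add hv
  | inv_of x _ =>
    rw [map_inv, magnus_of]
    exact hv.letter_symm x
  | mul x y hx hy => rw [magnus_mul_apply]; exact hx (hy hv)

/-- The elements of the free group acting trivially modulo terms of degree raised by `n`. -/
def filt (n : ℕ) : Subgroup (FreeGroup Bool) where
  carrier := {w | ∀ k v, Vanish k v → Vanish (k + n) (magnus w v - v)}
  one_mem' k v _ u _ := by simp
  mul_mem' {w z} hw hz k v hv := by
    have := (hw k _ (hv.magnus z)).add (hz k v hv)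
    rw [magnus_mul_apply]
    simpa using this
  inv_mem' {w} hw k v hv := by
    have := (hw k _ (hv.magnus w⁻¹)).neg
    rw [magnus_inv_cancel] at this
    simpa using this

lemma mem_filt_one (w : FreeGroup Bool) : w ∈ filt 1 := by
  induction w using FreeGroup.induction_on with
  | C1 => exact one_mem _
  | of x => intro k v hv; rw [magnus_of]; exact hv.letter x
  | inv_of x h => exact inv_mem h
  | mul x y hx hy => exact mul_mem hx hy

/-- With v = zw·v', the difference [w, z]v − v equals (wz − zw)v' = ((w − 1)(z − 1) − (z − 1)(w −
1))v', and each product raises degrees by n + m. -/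
lemma commutator_mem_filt {n m : ℕ} {w z : FreeGroup Bool} (hw : w ∈ filt n) (hz : z ∈ filt m) :
    ⁅w, z⁆ ∈ filt (n + m) := by
  intro k v hv
  set v' := magnus (z * w)⁻¹ v with hv'
  have hk : Vanish k v' := hv.magnus _
  have e1 : magnus ⁅w, z⁆ v = magnus w (magnus z v') := by
    rw [hv', ← magnus_mul_apply, ← magnus_mul_apply, commutatorElement_def]
    congr 2; group
  have e2 : v = magnus z (magnus w v') := by
    rw [hv', ← magnus_mul_apply, magnus_inv_cancel]
  have h1 := hw _ _ (hz k v' hk)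
  have h2 := hz _ _ (hw k v' hk)
  rw [show k + m + n = k + (n + m) by ring] at h1
  rw [show k + n + m = k + (n + m) by ring] at h2
  have h3 := h1.sub h2
  have e3 : magnus ⁅w, z⁆ v - v = magnus w (magnus z v') - magnus z (magnus w v') := by
    rw [e1, ← e2]
  rw [e3]
  convert h3 using 1
  simp only [map_sub]
  abel

/-- The coefficients of the Magnus expansion. -/
noncomputable def coef (w : FreeGroup Bool) : Series := magnus w (Pi.single [] 1)

lemma vanish_coef_sub {n : ℕ} {w : FreeGroup Bool} (hw : w ∈ filt n) :
    Vanish n (coef w - Pi.single [] 1) := by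
  simpa [coef] using hw 0 (Pi.single [] 1) (fun u hu => absurd hu (Nat.not_lt_zero _))

lemma coef_nil (w : FreeGroup Bool) : coef w [] = 1 := by
  have := vanish_coef_sub (mem_filt_one w) [] (by simp)
  simpa [sub_eq_zero] using this

lemma coef_eq_zero {n : ℕ} {w : FreeGroup Bool} (hw : w ∈ filt n) {u : List Bool}
    (hu : u.length < n) (h0 : u ≠ []) : coef w u = 0 := by
  have := vanish_coef_sub hw u hu
  simpa [h0] using this

/-- In wz − 1 = (w − 1) + (z − 1) + (w − 1)(z − 1) the last product starts in degree n + m. For n =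
m = 5 this makes coefficients up to length 9 additive. -/
lemma coef_mul_of_mem_filt {n m : ℕ} {w z : FreeGroup Bool} (hw : w ∈ filt n) (hz : z ∈ filt m)
    {u : List Bool} (hu : u.length < n + m) (h0 : u ≠ []) :
    coef (w * z) u = coef w u + coef z u := by
  have h := hw _ _ (vanish_coef_sub hz) u (by omega)
  have e : coef (w * z) = magnus w (coef z) := magnus_mul_apply _ _ _
  rw [e]
  simp only [map_sub, Pi.sub_apply] at h
  have e' : magnus w (Pi.single [] 1) u = coef w u := rfl
  rw [e'] at h
  simp only [Pi.single_apply, h0, if_false] at h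
  linarith

/-- Multiplication of formal series. -/
def conv (f : Series) (v : Series) : Series
  | [] => f [] * v []
  | y :: u => f [] * v (y :: u) + conv (fun t => f (y :: t)) v u

lemma conv_add (f g v : Series) : conv (f + g) v = conv f v + conv g v := by
  funext u
  induction u generalizing f g with
  | nil => simp [conv, add_mul]
  | cons y u ih =>
    have := ih (fun t => f (y :: t)) (fun t => g (y :: t))
    simp only [conv, Pi.add_apply]
    rw [show (fun t => f (y :: t) + g (y :: t)) = (fun t => f (y :: t)) + fun t => g (y :: t) from rfl,
      this]
    simp only [Pi.add_apply]
    ring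

lemma conv_zero (v : Series) : conv 0 v = 0 := by
  have := conv_add 0 0 v
  simpa using this

lemma conv_single (v : Series) : conv (Pi.single [] 1) v = v := by
  funext u
  cases u with
  | nil => simp [conv]
  | cons y u =>
    have h : (fun t : List Bool => (Pi.single [] 1 : Series) (y :: t)) = 0 := by
      funext t; simp
    simp only [conv, h, conv_zero]
    simp

lemma letter_conv (x : Bool) (f v : Series) : letter x (conv f v) = conv (letter x f) v := by
  funext u
  show letterFun x (conv f v) u = conv (letterFun x f) v u
  cases u with
  | nil => rfl
  | cons y u =>
    by_cases h : y = x
    · have : (fun t => letterFun x f (y :: t)) = (fun t => f (y :: t)) + f := by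
        funext t; simp [letterFun, h]
      simp only [letterFun, conv]
      rw [show (fun t => f (y :: t) + if y = x then f t else 0) = (fun t => f (y :: t)) + f from this,
        conv_add]
      simp only [h, if_true, Pi.add_apply]
      ring
    · simp only [letterFun, conv, h, if_false, add_zero]

/-- Left multiplications commute with right multiplication by v. This identifies the representation
with multiplication of power series, which is needed for coefficients beyond the additive range. -/
lemma magnus_conv (w : FreeGroup Bool) (f v : Series) :
    magnus w (conv f v) = conv (magnus w f) v := by
  induction w using FreeGroup.induction_on generalizing f with
  | C1 => simp
  | of x => rw [magnus_of]; exact letter_conv x f v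
  | inv_of x _ =>
    have e : (magnus (FreeGroup.of x)⁻¹ : Series ≃ₗ[ℤ] Series) = (letter x).symm := by
      rw [map_inv, magnus_of]; rfl
    rw [e, LinearEquiv.symm_apply_eq, letter_conv, LinearEquiv.apply_symm_apply]
  | mul x y hx hy => rw [magnus_mul_apply, magnus_mul_apply, hy, hx]

lemma coef_mul (w z : FreeGroup Bool) : coef (w * z) = conv (coef w) (coef z) := by
  have e : coef (w * z) = magnus w (coef z) := magnus_mul_apply _ _ _
  rw [e, coef, coef, ← magnus_conv, conv_single]

end MagnusRep

/-! ### Commutator calculus modulo terms of the lower central series -/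

namespace LowerCentral

variable {H : Type*} [Group H]

/-- The lower central series of `H`, indexed so that `gam 0 = gam 1 = ⊤`. -/
def gam (H : Type*) [Group H] : ℕ → Subgroup H
  | 0 => ⊤
  | 1 => ⊤
  | n + 2 => ⁅gam H (n + 1), ⊤⁆

instance gam_normal : ∀ n, (gam H n).Normal
  | 0 => inferInstanceAs (⊤ : Subgroup H).Normal
  | 1 => inferInstanceAs (⊤ : Subgroup H).Normal
  | n + 2 => by
    have := gam_normal (n + 1)
    exact inferInstanceAs (⁅gam H (n + 1), (⊤ : Subgroup H)⁆).Normal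

lemma gam_succ_eq (n : ℕ) : gam H (n + 1) = (⊤ : Subgroup H).lowerCentralSeries n := by
  induction n with
  | zero => rfl
  | succ n ih => rw [Subgroup.lowerCentralSeries_succ, ← ih]; rfl

lemma gam_succ_le (n : ℕ) : gam H (n + 1) ≤ gam H n := by
  cases n with
  | zero => exact le_top
  | succ n => exact Subgroup.commutator_le_left _ _

lemma gam_antitone : Antitone (gam H) := antitone_nat_of_succ_le gam_succ_le

lemma comm_mem_gam_succ {n : ℕ} {x : H} (hx : x ∈ gam H n) (hn : 1 ≤ n) (y : H) :
    ⁅x, y⁆ ∈ gam H (n + 1) := by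
  obtain ⟨m, rfl⟩ : ∃ m, n = m + 1 := ⟨n - 1, by omega⟩
  exact Subgroup.commutator_mem_commutator hx (Subgroup.mem_top y)

/-- The three subgroups lemma, applied in the quotient by N. -/
lemma commutator_commutator_le_of_rotate {A B C N : Subgroup H} [N.Normal]
    (h1 : ⁅⁅B, C⁆, A⁆ ≤ N) (h2 : ⁅⁅C, A⁆, B⁆ ≤ N) : ⁅⁅A, B⁆, C⁆ ≤ N := by
  have key : ∀ K : Subgroup H, K ≤ N ↔ K.map (QuotientGroup.mk' N) = ⊥ := fun K => by
    rw [Subgroup.map_eq_bot_iff, QuotientGroup.ker_mk']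
  rw [key, Subgroup.map_commutator, Subgroup.map_commutator] at h1 h2 ⊢
  exact Subgroup.commutator_commutator_eq_bot_of_rotate h1 h2

lemma gam_comm_le (i j : ℕ) : ⁅gam H i, gam H j⁆ ≤ gam H (i + j) := by
  induction j generalizing i with
  | zero => exact Subgroup.commutator_le_left _ _
  | succ j ih =>
    cases j with
    | zero =>
      cases i with
      | zero => exact le_top
      | succ i => exact le_refl _
    | succ j =>
      cases i with
      | zero => rw [zero_add]; exact Subgroup.commutator_le_right _ _
      | succ i =>
        rw [Subgroup.commutator_comm]
        show ⁅⁅gam H (j + 1), ⊤⁆, gam H (i + 1)⁆ ≤ _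
        apply commutator_commutator_le_of_rotate
        · rw [Subgroup.commutator_comm ⊤]
          refine (ih (i + 2)).trans (gam_antitone (by omega))
        · refine (Subgroup.commutator_mono (ih (i + 1)) le_top).trans ?_
          show gam H (i + 1 + j + 1 + 1) ≤ _
          exact gam_antitone (by omega)

lemma comm_mem_gam {i j n : ℕ} {x y : H} (hx : x ∈ gam H i) (hy : y ∈ gam H j) (h : n ≤ i + j) :
    ⁅x, y⁆ ∈ gam H n :=
  gam_antitone h (gam_comm_le i j (Subgroup.commutator_mem_commutator hx hy))

lemma mem_gam_one (x : H) : x ∈ gam H 1 := Subgroup.mem_top x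

/-- Reduction modulo a term of the lower central series. -/
abbrev red (n : ℕ) : H →* H ⧸ gam H n := QuotientGroup.mk' (gam H n)

lemma red_eq_one {n : ℕ} {x : H} : red n x = 1 ↔ x ∈ gam H n := QuotientGroup.eq_one_iff x

lemma red_eq_iff {n : ℕ} {x y : H} : red n x = red n y ↔ x⁻¹ * y ∈ gam H n := by
  rw [← red_eq_one, map_mul, map_inv, inv_mul_eq_one]

lemma red_commute {i j n : ℕ} {x y : H} (hx : x ∈ gam H i) (hy : y ∈ gam H j) (h : n ≤ i + j) :
    Commute (red n x) (red n y) := by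
  rw [← commutatorElement_eq_one_iff_commute, ← map_commutatorElement, red_eq_one]
  exact comm_mem_gam hx hy h

lemma red_comm_congr {m j n : ℕ} {x x' y : H} (hx : red m x = red m x') (hy : y ∈ gam H j)
    (h : n ≤ m + j) : red n ⁅x, y⁆ = red n ⁅x', y⁆ := by
  obtain ⟨t, ht, rfl⟩ : ∃ t ∈ gam H m, x' = x * t :=
    ⟨x⁻¹ * x', red_eq_iff.1 hx, by group⟩
  have ht' : red n ⁅t, y⁆ = 1 := red_eq_one.2 (comm_mem_gam ht hy h)
  rw [commutatorElement_mul_left_eq_conj_mul]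
  simp only [map_mul, ht', mul_one, map_inv, mul_inv_cancel, one_mul]

lemma red_comm_congr_right {m j n : ℕ} {x y y' : H} (hy : red m y = red m y') (hx : x ∈ gam H j)
    (h : n ≤ m + j) : red n ⁅x, y⁆ = red n ⁅x, y'⁆ := by
  rw [← commutatorElement_inv y x, ← commutatorElement_inv y' x, map_inv, map_inv,
    red_comm_congr hy hx h]

/-- The conjugation in [xx', y] = x[x', y]x⁻¹·[x, y] disappears modulo γ_{i+j+1}; with
`red_comm_inv_left` this gives additivity of the bracket in the associated graded Lie ring. -/
lemma red_comm_mul_left {i j n : ℕ} {x x' y : H} (hx : x ∈ gam H i) (hx' : x' ∈ gam H i)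
    (hy : y ∈ gam H j) (hi : 1 ≤ i) (h : n ≤ i + j + 1) :
    red n ⁅x * x', y⁆ = red n ⁅x, y⁆ * red n ⁅x', y⁆ := by
  have h1 := red_commute (n := n) hx (comm_mem_gam hx' hy le_rfl) (by omega)
  have h2 := red_commute (n := n) (comm_mem_gam hx hy le_rfl) (comm_mem_gam hx' hy le_rfl) (by omega)
  rw [commutatorElement_mul_left_eq_conj_mul]
  simp only [map_mul, map_inv]
  rw [h1.eq, mul_inv_cancel_right, h2.eq]

lemma red_comm_inv_left {i j n : ℕ} {x y : H} (hx : x ∈ gam H i)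
    (hy : y ∈ gam H j) (hi : 1 ≤ i) (h : n ≤ i + j + 1) :
    red n ⁅x⁻¹, y⁆ = (red n ⁅x, y⁆)⁻¹ := by
  have := red_comm_mul_left hx (inv_mem hx) hy hi h
  rw [mul_inv_cancel, commutatorElement_one_left, map_one] at this
  exact (inv_eq_of_mul_eq_one_right this.symm).symm

/-- The Hall–Witt identity, whose inner conjugations are invisible modulo the relevant term (`cj`):
the Jacobi identity of the graded Lie ring. -/
lemma red_jacobi {i j k n : ℕ} {x y z : H} (hx : x ∈ gam H i) (hy : y ∈ gam H j)
    (hz : z ∈ gam H k) (hi : 1 ≤ i) (hj : 1 ≤ j) (hk : 1 ≤ k) (h : n ≤ i + j + k + 1) :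
    red n ⁅x, ⁅y, z⁆⁆ = red n ⁅⁅x, y⁆, z⁆ * (red n ⁅⁅x, z⁆, y⁆)⁻¹ := by
  have cj : ∀ {l m : ℕ} {u v : H}, u ∈ gam H l → v ∈ gam H m → 1 ≤ m →
      red (l + 1) (v * u * v⁻¹) = red (l + 1) u := by
    intro l m u v hu hv hm
    have := red_commute (n := l + 1) hu hv (by omega)
    rw [map_mul, map_mul, map_inv, ← this.eq, mul_inv_cancel_right]
  have hxy := comm_mem_gam hx hy le_rfl
  have hyz := comm_mem_gam hy hz le_rfl
  have hzx := comm_mem_gam hz hx le_rfl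
  have hxz := comm_mem_gam hx hz le_rfl
  have hw := congrArg (red n) (commutatorElement_commutatorElement_conj_mul x y z)
  rw [map_mul, map_mul, map_one, red_comm_congr_right (cj hz hy hj) hxy (by omega),
    red_comm_congr_right (cj hx hz hk) hyz (by omega),
    red_comm_congr_right (cj hy hx hi) hzx (by omega), ← commutatorElement_inv x z,
    red_comm_inv_left hxz hy (by omega) (by omega), ← commutatorElement_inv x ⁅y, z⁆, map_inv] at hw
  have hc := red_commute (n := n) (comm_mem_gam hxy hz le_rfl) (comm_mem_gam hxz hy le_rfl) (by omega)
  rw [mul_inv_eq_one] at hw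
  rw [hc.inv_right.eq, ← hw]; group

/-- Commutation modulo a normal subgroup K is a subgroup condition in each argument, so it can be
tested on generators: on U for the first argument and on a, b for the second. This is the inductive
step for generating the lower central factors. -/
lemma gam_succ_le_sup_closure {a b : H} (hab : Subgroup.closure {a, b} = ⊤) {n : ℕ} (hn : 1 ≤ n)
    {U U' : Set H} (hU' : U' ⊆ gam H (n + 1))
    (hU : gam H n ≤ Subgroup.closure U ⊔ gam H (n + 1))
    (h : ∀ u ∈ U, ⁅u, a⁆ ∈ Subgroup.closure U' ⊔ gam H (n + 2) ∧
      ⁅u, b⁆ ∈ Subgroup.closure U' ⊔ gam H (n + 2)) :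
    gam H (n + 1) ≤ Subgroup.closure U' ⊔ gam H (n + 2) := by
  obtain ⟨m, rfl⟩ : ∃ m, n = m + 1 := ⟨n - 1, by omega⟩
  set K := Subgroup.closure U' ⊔ gam H (m + 1 + 2) with hK
  have hle : K ≤ gam H (m + 1 + 1) :=
    sup_le ((Subgroup.closure_le _).2 hU') (gam_succ_le _)
  -- Any subgroup between γ_{n+2} and γ_{n+1} is normal.
  have : K.Normal := by
    rw [← Subgroup.commutator_top_right_le_iff]
    exact (Subgroup.commutator_mono hle le_rfl).trans le_sup_right
  let C : H → Subgroup H := fun y =>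
    (Subgroup.centralizer {QuotientGroup.mk' K y}).comap (QuotientGroup.mk' K)
  have hC : ∀ x y, x ∈ C y ↔ ⁅x, y⁆ ∈ K := by
    intro x y
    rw [← QuotientGroup.eq_one_iff (N := K), ← QuotientGroup.mk'_apply, map_commutatorElement,
      commutatorElement_eq_one_iff_mul_comm, Subgroup.mem_comap, Subgroup.mem_centralizer_singleton_iff]
  have hC' : ∀ x y, x ∈ C y ↔ y ∈ C x := by
    intro x y
    rw [hC, hC, ← commutatorElement_inv, inv_mem_iff]
  have key : ∀ y ∈ ({a, b} : Set H), gam H (m + 1) ≤ C y := by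
    intro y hy
    refine hU.trans (sup_le ((Subgroup.closure_le _).2 fun u hu => ?_) fun u hu => ?_)
    · rw [SetLike.mem_coe, hC]
      rcases hy with rfl | rfl
      exacts [(h u hu).1, (h u hu).2]
    · rw [hC]
      exact Subgroup.mem_sup_right (comm_mem_gam_succ hu (by omega) y)
  show ⁅gam H (m + 1), ⊤⁆ ≤ K
  rw [Subgroup.commutator_le]
  intro x hx y _
  rw [← hC, hC']
  have : (⊤ : Subgroup H) ≤ C x := by
    rw [← hab, Subgroup.closure_le]
    intro z hz
    rw [SetLike.mem_coe, hC']
    exact key z hz hx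
  exact this (Subgroup.mem_top y)

end LowerCentral

/-! ### Left-normed commutators generating γ_5 modulo γ_8 -/

namespace LowerCentral

section Basis

variable {α : Type*} (br : α → α → α) (a b : α)

/-- Left-normed commutators of weight five, for an arbitrary bracket operation. -/
def basis5 : List α :=
  let c := br a b
  let d := br c a
  let e := br c b
  [br (br d a) a, br (br d a) b, br (br d b) a, br (br d b) b, br (br e b) a, br (br e b) b]

/-- Left-normed commutators of weight six, for an arbitrary bracket operation. -/
def basis6 : List α :=
  let c := br a b
  let d := br c a
  let e := br c b
  [br (br (br d a) a) a, br (br (br d a) b) a, br (br (br d b) a) a, br (br (br d a) b) b,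
    br (br (br d b) a) b, br (br (br d b) b) a, br (br (br d b) b) b, br (br (br e b) a) b,
    br (br (br e b) b) b]

/-- Left-normed commutators of weight seven, for an arbitrary bracket operation. -/
def basis7 : List α := (basis6 br a b).flatMap fun w => [br w a, br w b]

/-- Left-normed commutators of weights five, six and seven, for an arbitrary bracket operation. -/
def basis : List α := basis5 br a b ++ (basis6 br a b ++ basis7 br a b)

/-- Allows the same list to be formed from words, where it can be computed with, and from group
elements. -/
lemma map_basis {β : Type*} (br' : β → β → β) (f : α → β)
    (hf : ∀ x y, f (br x y) = br' (f x) (f y)) :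
    (basis br a b).map f = basis br' (f a) (f b) := by
  simp [basis, basis5, basis6, basis7, hf]

end Basis

variable {H : Type*} [Group H] {a b : H}

/-- The group commutator as a function. -/
abbrev gbr (x y : H) : H := ⁅x, y⁆

/-- The subgroup generated by a list of elements together with a term of the lower central
series. -/
def spn (L : List H) (n : ℕ) : Subgroup H := Subgroup.closure {x | x ∈ L} ⊔ gam H n

lemma mem_spn {L : List H} {n : ℕ} {x : H} (h : x ∈ L) : x ∈ spn L n :=
  Subgroup.mem_sup_left (Subgroup.subset_closure h)

lemma mem_spn_of_red_eq {L : List H} {n : ℕ} {x y : H} (h : red n y = red n x) (hy : y ∈ spn L n) :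
    x ∈ spn L n := by
  have h1 : y⁻¹ * x ∈ spn L n := Subgroup.mem_sup_right (red_eq_iff.1 h)
  simpa using mul_mem hy h1

lemma gam_two_le (hab : Subgroup.closure {a, b} = ⊤) : gam H 2 ≤ spn [⁅a, b⁆] 3 := by
  refine gam_succ_le_sup_closure hab le_rfl (U := {a, b}) ?_ ?_ ?_
  · intro x hx
    obtain rfl : x = ⁅a, b⁆ := by simpa using hx
    exact comm_mem_gam (mem_gam_one a) (mem_gam_one b) le_rfl
  · rw [hab]; exact le_sup_of_le_left le_top
  · have h : ⁅a, b⁆ ∈ spn [⁅a, b⁆] 3 := mem_spn (by simp)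
    rintro u (rfl | rfl)
    · exact ⟨by rw [commutatorElement_self]; exact one_mem _, h⟩
    · exact ⟨by rw [← commutatorElement_inv a]; exact inv_mem h,
        by rw [commutatorElement_self]; exact one_mem _⟩

lemma gam_three_le (hab : Subgroup.closure {a, b} = ⊤) :
    gam H 3 ≤ spn [⁅⁅a, b⁆, a⁆, ⁅⁅a, b⁆, b⁆] 4 := by
  have hc : ⁅a, b⁆ ∈ gam H 2 := comm_mem_gam (mem_gam_one a) (mem_gam_one b) le_rfl
  refine gam_succ_le_sup_closure hab (by norm_num) ?_ (gam_two_le hab) ?_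
  · intro x hx
    simp only [List.mem_cons, List.not_mem_nil, or_false, Set.mem_ofPred_eq] at hx
    rcases hx with rfl | rfl <;> exact comm_mem_gam_succ hc (by norm_num) _
  · intro u hu
    obtain rfl : u = ⁅a, b⁆ := by simpa using hu
    exact ⟨mem_spn (by simp), mem_spn (by simp)⟩

section Relations

variable (a b : H)

lemma mem2 : ⁅a, b⁆ ∈ gam H 2 := comm_mem_gam (mem_gam_one a) (mem_gam_one b) le_rfl

lemma mem3 (x : H) : ⁅⁅a, b⁆, x⁆ ∈ gam H 3 := comm_mem_gam_succ (mem2 a b) (by norm_num) x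

lemma mem4 (x y : H) : ⁅⁅⁅a, b⁆, x⁆, y⁆ ∈ gam H 4 :=
  comm_mem_gam_succ (mem3 a b x) (by norm_num) y

lemma mem5 (x y z : H) : ⁅⁅⁅⁅a, b⁆, x⁆, y⁆, z⁆ ∈ gam H 5 :=
  comm_mem_gam_succ (mem4 a b x y) (by norm_num) z

lemma mem6 (x y z t : H) : ⁅⁅⁅⁅⁅a, b⁆, x⁆, y⁆, z⁆, t⁆ ∈ gam H 6 :=
  comm_mem_gam_succ (mem5 a b x y z) (by norm_num) t

/-- Bracketing with `[a, b]` expressed through brackets with `a` and `b`. -/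
lemma red_comm_comm {n k : ℕ} {x : H} (hx : x ∈ gam H k) (hk : 1 ≤ k) (h : n ≤ k + 3) :
    red n ⁅x, ⁅a, b⁆⁆ = red n ⁅⁅x, a⁆, b⁆ * (red n ⁅⁅x, b⁆, a⁆)⁻¹ :=
  red_jacobi hx (mem_gam_one a) (mem_gam_one b) hk le_rfl le_rfl h

/-- Jacobi applied to [c, [a, b]] = [c, c] = 1, where c = [a, b]. -/
lemma red_weight_four :
    red 5 ⁅⁅⁅a, b⁆, b⁆, a⁆ = red 5 ⁅⁅⁅a, b⁆, a⁆, b⁆ := by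
  have h := red_comm_comm a b (n := 5) (mem2 a b) (by norm_num) (by norm_num)
  rw [commutatorElement_self, map_one, eq_comm, mul_inv_eq_one] at h
  exact h.symm

lemma red_comm_mul_inv {x y z : H} (hx : x ∈ gam H 5) (hy : y ∈ gam H 5) :
    red 7 ⁅x * y⁻¹, z⁆ = red 7 ⁅x, z⁆ * (red 7 ⁅y, z⁆)⁻¹ := by
  rw [red_comm_mul_left hx (inv_mem hy) (mem_gam_one z) (by norm_num) (by norm_num),
    red_comm_inv_left hy (mem_gam_one z) (by norm_num) (by norm_num)]

lemma red_d_c (z : H) : red 7 ⁅⁅⁅⁅a, b⁆, a⁆, ⁅a, b⁆⁆, z⁆ =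
    red 7 ⁅⁅⁅⁅⁅a, b⁆, a⁆, a⁆, b⁆, z⁆ * (red 7 ⁅⁅⁅⁅⁅a, b⁆, a⁆, b⁆, a⁆, z⁆)⁻¹ := by
  rw [← red_comm_mul_inv (mem5 a b _ _ _) (mem5 a b _ _ _)]
  refine red_comm_congr (m := 6) ?_ (mem_gam_one z) (by norm_num)
  rw [red_comm_comm a b (mem3 a b a) (by norm_num) (by norm_num), map_mul, map_inv]

lemma red_e_c (z : H) : red 7 ⁅⁅⁅⁅a, b⁆, b⁆, ⁅a, b⁆⁆, z⁆ =
    red 7 ⁅⁅⁅⁅⁅a, b⁆, a⁆, b⁆, b⁆, z⁆ * (red 7 ⁅⁅⁅⁅⁅a, b⁆, b⁆, b⁆, a⁆, z⁆)⁻¹ := by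
  rw [← red_comm_mul_inv (mem5 a b _ _ _) (mem5 a b _ _ _)]
  refine red_comm_congr (m := 6) ?_ (mem_gam_one z) (by norm_num)
  rw [red_comm_comm a b (mem3 a b b) (by norm_num) (by norm_num), map_mul, map_inv,
    red_comm_congr (red_weight_four a b) (mem_gam_one b) (by norm_num)]

/-- With c = [a, b] and d = [c, a], Jacobi applied to [d, [c, a]] = [d, d] = 1 expresses [d, a, a,
b] through two commutators kept in `basis6`. -/
lemma red_weight_six_left : red 7 ⁅⁅⁅⁅⁅a, b⁆, a⁆, a⁆, a⁆, b⁆ =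
    red 7 (⁅⁅⁅⁅⁅a, b⁆, a⁆, a⁆, b⁆, a⁆ * ⁅⁅⁅⁅⁅a, b⁆, a⁆, b⁆, a⁆, a⁆⁻¹ *
      ⁅⁅⁅⁅⁅a, b⁆, a⁆, a⁆, b⁆, a⁆) := by
  have h := red_jacobi (n := 7) (mem3 a b a) (mem2 a b) (mem_gam_one a) (by norm_num) (by norm_num)
    le_rfl (by norm_num)
  rw [commutatorElement_self, map_one, red_d_c,
    red_comm_comm a b (mem4 a b a a) (by norm_num) (by norm_num), eq_comm, mul_inv_eq_one] at h
  rw [map_mul, map_mul, map_inv, h, inv_mul_cancel_right]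

/-- The counterpart for e = [c, b], obtained from [e, [c, b]] = [e, e] = 1. -/
lemma red_weight_six_right : red 7 ⁅⁅⁅⁅⁅a, b⁆, b⁆, b⁆, b⁆, a⁆ =
    red 7 (⁅⁅⁅⁅⁅a, b⁆, b⁆, b⁆, a⁆, b⁆ * ⁅⁅⁅⁅⁅a, b⁆, a⁆, b⁆, b⁆, b⁆⁻¹ *
      ⁅⁅⁅⁅⁅a, b⁆, b⁆, b⁆, a⁆, b⁆) := by
  have h := red_jacobi (n := 7) (mem3 a b b) (mem2 a b) (mem_gam_one b) (by norm_num) (by norm_num)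
    le_rfl (by norm_num)
  rw [commutatorElement_self, map_one, red_e_c,
    red_comm_comm a b (mem4 a b b b) (by norm_num) (by norm_num), eq_comm, mul_inv_eq_one] at h
  rw [map_mul, map_mul, map_inv, ← inv_inj, ← mul_right_inj (red 7 ⁅⁅⁅⁅⁅a, b⁆, b⁆, b⁆, a⁆, b⁆), ← h]
  group

/-- Antisymmetry: [d, e] and [e, d]⁻¹ are expanded by Jacobi through d, c, b and through e, c, a
respectively, and the two results are compared. -/
lemma red_weight_six_middle : red 7 ⁅⁅⁅⁅⁅a, b⁆, b⁆, b⁆, a⁆, a⁆ =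
    red 7 ((⁅⁅⁅⁅⁅a, b⁆, a⁆, b⁆, b⁆, a⁆ * ⁅⁅⁅⁅⁅a, b⁆, a⁆, b⁆, a⁆, b⁆⁻¹) *
      ((⁅⁅⁅⁅⁅a, b⁆, a⁆, a⁆, b⁆, b⁆ * ⁅⁅⁅⁅⁅a, b⁆, a⁆, b⁆, a⁆, b⁆⁻¹) *
      (⁅⁅⁅⁅⁅a, b⁆, a⁆, b⁆, b⁆, a⁆ * ⁅⁅⁅⁅⁅a, b⁆, a⁆, b⁆, a⁆, b⁆⁻¹)) *
      ⁅⁅⁅⁅⁅a, b⁆, a⁆, b⁆, b⁆, a⁆) := by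
  have h1 := red_jacobi (n := 7) (mem3 a b a) (mem2 a b) (mem_gam_one b) (by norm_num) (by norm_num)
    le_rfl (by norm_num)
  have h2 := red_jacobi (n := 7) (mem3 a b b) (mem2 a b) (mem_gam_one a) (by norm_num) (by norm_num)
    le_rfl (by norm_num)
  rw [red_d_c, red_comm_comm a b (mem4 a b a b) (by norm_num) (by norm_num)] at h1
  rw [red_e_c, red_comm_congr (red_weight_four a b) (mem2 a b) (by norm_num),
    red_comm_comm a b (mem4 a b a b) (by norm_num) (by norm_num), ← commutatorElement_inv, map_inv,
    h1] at h2
  simp only [map_mul, map_inv]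
  generalize red 7 ⁅⁅⁅⁅⁅a, b⁆, a⁆, b⁆, b⁆, a⁆ = p at *
  generalize red 7 ⁅⁅⁅⁅⁅a, b⁆, a⁆, b⁆, a⁆, b⁆ = q at *
  generalize red 7 ⁅⁅⁅⁅⁅a, b⁆, a⁆, a⁆, b⁆, b⁆ = r at *
  generalize red 7 ⁅⁅⁅⁅⁅a, b⁆, b⁆, b⁆, a⁆, a⁆ = s at *
  have h3 : s = ((r * q⁻¹ * (q * p⁻¹)⁻¹)⁻¹ * (q * p⁻¹))⁻¹ * p := by
    rw [h2]; group
  rw [h3]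
  group

end Relations

variable {a b : H}

lemma gam_four_le (hab : Subgroup.closure {a, b} = ⊤) :
    gam H 4 ≤ spn [⁅⁅⁅a, b⁆, a⁆, a⁆, ⁅⁅⁅a, b⁆, a⁆, b⁆, ⁅⁅⁅a, b⁆, b⁆, b⁆] 5 := by
  refine gam_succ_le_sup_closure hab (by norm_num) ?_ (gam_three_le hab) ?_
  · intro x hx
    simp only [List.mem_cons, List.not_mem_nil, or_false, Set.mem_ofPred_eq] at hx
    rcases hx with rfl | rfl | rfl <;> exact mem4 a b _ _
  · intro u hu
    simp only [List.mem_cons, List.not_mem_nil, or_false, Set.mem_ofPred_eq] at hu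
    rcases hu with rfl | rfl
    · exact ⟨mem_spn (by simp), mem_spn (by simp)⟩
    · exact ⟨mem_spn_of_red_eq (red_weight_four a b).symm (mem_spn (by simp)), mem_spn (by simp)⟩

lemma basis5_subset : {x | x ∈ basis5 gbr a b} ⊆ (gam H 5 : Set H) := by
  intro x hx
  simp only [basis5, gbr, List.mem_cons, List.not_mem_nil, or_false, Set.mem_ofPred_eq] at hx
  rcases hx with rfl | rfl | rfl | rfl | rfl | rfl <;> exact mem5 a b _ _ _

lemma basis6_subset : {x | x ∈ basis6 gbr a b} ⊆ (gam H 6 : Set H) := by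
  intro x hx
  simp only [basis6, gbr, List.mem_cons, List.not_mem_nil, or_false, Set.mem_ofPred_eq] at hx
  rcases hx with rfl | rfl | rfl | rfl | rfl | rfl | rfl | rfl | rfl <;> exact mem6 a b _ _ _ _

lemma basis7_subset : {x | x ∈ basis7 gbr a b} ⊆ (gam H 7 : Set H) := by
  intro x hx
  simp only [basis7, List.mem_flatMap, Set.mem_ofPred_eq] at hx
  obtain ⟨w, hw, hx⟩ := hx
  have := basis6_subset hw
  simp only [gbr, List.mem_cons, List.not_mem_nil, or_false] at hx
  rcases hx with rfl | rfl <;> exact comm_mem_gam_succ this (by norm_num) _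

lemma gam_five_le (hab : Subgroup.closure {a, b} = ⊤) : gam H 5 ≤ spn (basis5 gbr a b) 6 := by
  refine gam_succ_le_sup_closure hab (by norm_num) basis5_subset (gam_four_le hab) ?_
  intro u hu
  simp only [List.mem_cons, List.not_mem_nil, or_false, Set.mem_ofPred_eq] at hu
  rcases hu with rfl | rfl | rfl <;>
    exact ⟨mem_spn (by simp [basis5]), mem_spn (by simp [basis5])⟩

/-- Bracketing the six generators of weight five with a and b gives twelve commutators; the three
relations of weight six remove the ones outside `basis6`. -/
lemma gam_six_le (hab : Subgroup.closure {a, b} = ⊤) : gam H 6 ≤ spn (basis6 gbr a b) 7 := by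
  refine gam_succ_le_sup_closure hab (by norm_num) basis6_subset (gam_five_le hab) ?_
  intro u hu
  simp only [basis5, gbr, List.mem_cons, List.not_mem_nil, or_false, Set.mem_ofPred_eq] at hu
  have key : ∀ {x : H}, x ∈ basis6 gbr a b → x ∈ spn (basis6 gbr a b) 7 := fun h => mem_spn h
  rcases hu with rfl | rfl | rfl | rfl | rfl | rfl
  · refine ⟨key (by simp [basis6]), mem_spn_of_red_eq (red_weight_six_left a b).symm ?_⟩
    exact mul_mem (mul_mem (key (by simp [basis6])) (inv_mem (key (by simp [basis6]))))
      (key (by simp [basis6]))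
  · exact ⟨key (by simp [basis6]), key (by simp [basis6])⟩
  · exact ⟨key (by simp [basis6]), key (by simp [basis6])⟩
  · exact ⟨key (by simp [basis6]), key (by simp [basis6])⟩
  · refine ⟨mem_spn_of_red_eq (red_weight_six_middle a b).symm ?_, key (by simp [basis6])⟩
    have h1 := mul_mem (key (x := ⁅⁅⁅⁅⁅a, b⁆, a⁆, b⁆, b⁆, a⁆) (by simp [basis6]))
      (inv_mem (key (x := ⁅⁅⁅⁅⁅a, b⁆, a⁆, b⁆, a⁆, b⁆) (by simp [basis6])))
    have h2 := mul_mem (key (x := ⁅⁅⁅⁅⁅a, b⁆, a⁆, a⁆, b⁆, b⁆) (by simp [basis6]))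
      (inv_mem (key (x := ⁅⁅⁅⁅⁅a, b⁆, a⁆, b⁆, a⁆, b⁆) (by simp [basis6])))
    exact mul_mem (mul_mem h1 (mul_mem h2 h1)) (key (by simp [basis6]))
  · refine ⟨mem_spn_of_red_eq (red_weight_six_right a b).symm ?_, key (by simp [basis6])⟩
    exact mul_mem (mul_mem (key (by simp [basis6])) (inv_mem (key (by simp [basis6]))))
      (key (by simp [basis6]))

lemma gam_seven_le (hab : Subgroup.closure {a, b} = ⊤) : gam H 7 ≤ spn (basis7 gbr a b) 8 := by
  refine gam_succ_le_sup_closure hab (by norm_num) basis7_subset (gam_six_le hab) ?_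
  intro u hu
  exact ⟨mem_spn (List.mem_flatMap.2 ⟨u, hu, by simp⟩), mem_spn (List.mem_flatMap.2 ⟨u, hu, by simp⟩)⟩

lemma mem_gam_five_of_mem_basis {x : H} (hx : x ∈ basis gbr a b) : x ∈ gam H 5 := by
  rcases List.mem_append.1 hx with h | h
  · exact basis5_subset h
  rcases List.mem_append.1 h with h | h
  · exact gam_antitone (by norm_num) (basis6_subset h)
  · exact gam_antitone (by norm_num) (basis7_subset h)

lemma gam_five_le_spn_basis (hab : Subgroup.closure {a, b} = ⊤) :
    gam H 5 ≤ spn (basis gbr a b) 8 := by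
  have h : ∀ {L : List H}, L ⊆ basis gbr a b →
      Subgroup.closure {x | x ∈ L} ≤ spn (basis gbr a b) 8 :=
    fun hL => (Subgroup.closure_mono fun x hx => hL hx).trans le_sup_left
  refine (gam_five_le hab).trans (sup_le (h fun x hx => by simp [basis, hx]) ?_)
  refine (gam_six_le hab).trans (sup_le (h fun x hx => by simp [basis, hx]) ?_)
  exact (gam_seven_le hab).trans (sup_le (h fun x hx => by simp [basis, hx]) le_sup_right)

end LowerCentral

/-! ### Verified computation of Magnus coefficients -/

namespace MagnusRep

open LowerCentral

lemma gam_le_filt : ∀ n, gam (FreeGroup Bool) n ≤ filt n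
  | 0 => fun _ _ k v hv => (hv.magnus _).sub hv
  | 1 => fun w _ => mem_filt_one w
  | n + 2 => by
    show ⁅gam (FreeGroup Bool) (n + 1), ⊤⁆ ≤ _
    rw [Subgroup.commutator_le]
    exact fun w hw z _ => commutator_mem_filt (n := n + 1) (gam_le_filt (n + 1) hw) (mem_filt_one z)

/-- A finite table of coefficients, indexed by a suffix closed set of words. -/
inductive Tree
  | nil : Tree
  | node : ℤ → Tree → Tree → Tree

namespace Tree

/-- The coefficients of `v` at the words ending in `p` are listed by the tree. -/
def Rep (v : Series) : Tree → List Bool → Prop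
  | nil, _ => True
  | node z l r, p => v p = z ∧ Rep v l (false :: p) ∧ Rep v r (true :: p)

/-- Multiplication by `1 + x` on the left. -/
def mulLetter (x : Bool) : ℤ → Tree → Tree
  | _, nil => nil
  | e, node z l r =>
    node (z + e) (mulLetter x (cond x 0 z) l) (mulLetter x (cond x z 0) r)

/-- Multiplication by `(1 + x)⁻¹` on the left. -/
def mulLetterInv (x : Bool) : ℤ → Tree → Tree
  | _, nil => nil
  | e, node z l r =>
    node (z - e) (mulLetterInv x (cond x 0 (z - e)) l) (mulLetterInv x (cond x (z - e) 0) r)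

def mulSign (x : Bool × Bool) (t : Tree) : Tree :=
  cond x.2 (mulLetter x.1 0 t) (mulLetterInv x.1 0 t)

/-- The table of the Magnus coefficients of a word, of the same shape as `t`. -/
def eval (t : Tree) (L : List (Bool × Bool)) : Tree := L.foldr mulSign t

/-- The entry at a word, given in reverse order. -/
def get : Tree → List Bool → Option ℤ
  | nil, _ => none
  | node z _ _, [] => some z
  | node _ l r, y :: u => cond y (get r u) (get l u)

/-- Insertion of a zero entry at a word given in reverse order, and at all its suffixes. -/
def insert : List Bool → Tree → Tree
  | [], nil => node 0 nil nil
  | [], t => t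
  | y :: u, nil => cond y (node 0 nil (insert u nil)) (node 0 (insert u nil) nil)
  | y :: u, node z l r => cond y (node z l (insert u r)) (node z (insert u l) r)

def isZero : Tree → Bool
  | nil => true
  | node z l r => z == 0 && (isZero l && isZero r)

/-- The coefficient of (1 + x)v at a word depends only on v at that word and at its tail, so a
suffix-closed table suffices; the integer argument carries the contribution of the tail down the
tree. -/
lemma Rep.mulLetter {v : Series} (x : Bool) {t : Tree} {y : Bool} {p : List Bool}
    (h : Rep v t (y :: p)) :
    Rep (letter x v) (t.mulLetter x (if y = x then v p else 0)) (y :: p) := by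
  induction t generalizing y p with
  | nil => trivial
  | node z l r hl hr =>
    obtain ⟨hz, h1, h2⟩ := h
    refine ⟨?_, ?_, ?_⟩
    · show v (y :: p) + _ = _
      rw [hz]
    · have := hl h1
      rw [hz] at this
      cases x <;> simpa using this
    · have := hr h2
      rw [hz] at this
      cases x <;> simpa using this

lemma Rep.mulLetter_nil {v : Series} (x : Bool) {t : Tree} (h : Rep v t []) :
    Rep (letter x v) (t.mulLetter x 0) [] := by
  cases t with
  | nil => trivial
  | node z l r =>
    obtain ⟨hz, h1, h2⟩ := h
    refine ⟨?_, ?_, ?_⟩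
    · show v [] = _
      rw [hz, add_zero]
    · have := h1.mulLetter x
      rw [hz] at this
      cases x <;> simpa using this
    · have := h2.mulLetter x
      rw [hz] at this
      cases x <;> simpa using this

/-- From (1 + x)v' = v one gets v' = v − xv', so here the value passed to the children is the new
one instead of the old one. -/
lemma Rep.mulLetterInv {v : Series} (x : Bool) {t : Tree} {y : Bool} {p : List Bool}
    (h : Rep v t (y :: p)) :
    Rep ((letter x).symm v)
      (t.mulLetterInv x (if y = x then (letter x).symm v p else 0)) (y :: p) := by
  induction t generalizing y p with
  | nil => trivial
  | node z l r hl hr =>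
    obtain ⟨hz, h1, h2⟩ := h
    have e : (letter x).symm v (y :: p) = z - (if y = x then (letter x).symm v p else 0) := by
      rw [← hz]; rfl
    refine ⟨e, ?_, ?_⟩
    · have := hl h1
      rw [e] at this
      cases x <;> simpa using this
    · have := hr h2
      rw [e] at this
      cases x <;> simpa using this

lemma Rep.mulLetterInv_nil {v : Series} (x : Bool) {t : Tree} (h : Rep v t []) :
    Rep ((letter x).symm v) (t.mulLetterInv x 0) [] := by
  cases t with
  | nil => trivial
  | node z l r =>
    obtain ⟨hz, h1, h2⟩ := h
    have e : (letter x).symm v [] = z - 0 := by rw [← hz, sub_zero]; rfl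
    refine ⟨e, ?_, ?_⟩
    · have := h1.mulLetterInv x
      rw [e] at this
      cases x <;> simpa using this
    · have := h2.mulLetterInv x
      rw [e] at this
      cases x <;> simpa using this

lemma Rep.eval {t : Tree} (h : Rep (Pi.single [] 1) t []) (L : List (Bool × Bool)) :
    Rep (coef (FreeGroup.mk L)) (t.eval L) [] := by
  induction L with
  | nil =>
    have : coef (FreeGroup.mk []) = Pi.single [] 1 := by
      rw [← FreeGroup.one_eq_mk, coef, map_one]; rfl
    rw [this]; exact h
  | cons x L ih =>
    obtain ⟨x, s⟩ := x
    have e : coef (FreeGroup.mk ((x, s) :: L)) = magnus (FreeGroup.mk [(x, s)]) (coef (FreeGroup.mk L)) := by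
      rw [coef, coef, ← magnus_mul_apply, FreeGroup.mul_mk]; rfl
    rw [e]
    cases s with
    | true =>
      rw [show FreeGroup.mk [(x, true)] = FreeGroup.of x from rfl, magnus_of]
      exact ih.mulLetter_nil x
    | false =>
      rw [show FreeGroup.mk [(x, false)] = (FreeGroup.of x)⁻¹ from rfl, map_inv, magnus_of]
      exact ih.mulLetterInv_nil x

lemma Rep.of_isZero {t : Tree} (h : t.isZero = true) {p : List Bool} (hp : p ≠ []) :
    Rep (Pi.single [] 1) t p := by
  induction t generalizing p with
  | nil => trivial
  | node z l r hl hr =>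
    simp only [isZero, Bool.and_eq_true, beq_iff_eq] at h
    exact ⟨by simp [h.1, hp], hl h.2.1 (by simp), hr h.2.2 (by simp)⟩

lemma Rep.get {v : Series} {t : Tree} {p u : List Bool} {z : ℤ} (h : Rep v t p)
    (hz : t.get u = some z) : v (u.reverse ++ p) = z := by
  induction t generalizing p u with
  | nil => simp [Tree.get] at hz
  | node c l r hl hr =>
    cases u with
    | nil =>
      simp only [Tree.get, Option.some.injEq] at hz
      rw [← hz]; exact h.1
    | cons y u =>
      cases y
      · have := hl h.2.1 hz
        simpa using this
      · have := hr h.2.2 hz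
        simpa using this

end Tree

/-- The Lyndon words of lengths five, six and seven. -/
def lyndon : List (List Bool) :=
  let a := false
  let b := true
  [[a, a, a, a, b], [a, a, a, b, b], [a, a, b, a, b], [a, a, b, b, b], [a, b, a, b, b],
    [a, b, b, b, b], [a, a, a, a, a, b], [a, a, a, a, b, b], [a, a, a, b, a, b],
    [a, a, a, b, b, b], [a, a, b, a, b, b], [a, a, b, b, a, b], [a, a, b, b, b, b],
    [a, b, a, b, b, b], [a, b, b, b, b, b], [a, a, a, a, a, a, b], [a, a, a, a, a, b, b],
    [a, a, a, a, b, a, b], [a, a, a, a, b, b, b], [a, a, a, b, a, a, b], [a, a, a, b, a, b, b],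
    [a, a, a, b, b, a, b], [a, a, a, b, b, b, b], [a, a, b, a, a, b, b], [a, a, b, a, b, a, b],
    [a, a, b, a, b, b, b], [a, a, b, b, a, b, b], [a, a, b, b, b, a, b], [a, a, b, b, b, b, b],
    [a, b, a, b, a, b, b], [a, b, a, b, b, b, b], [a, b, b, a, b, b, b], [a, b, b, b, b, b, b]]

/-- A table of zeros, apart from the leading one, with entries at the Lyndon words. -/
def oneTree : Tree := (lyndon.map List.reverse).foldr Tree.insert (.node 1 .nil .nil)

/-- Evaluates an integer to a literal before passing it on. -/
noncomputable def force {α : Type} (z : ℤ) (f : ℤ → α) : α :=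
  Int.rec (fun n => Nat.rec (f (.ofNat 0)) (fun k _ => f (.ofNat (k + 1))) n)
    (fun n => Nat.rec (f (.negSucc 0)) (fun k _ => f (.negSucc (k + 1))) n) z

lemma force_eq {α : Type} (z : ℤ) (f : ℤ → α) : force z f = f z := by
  rcases z with (_ | _) | (_ | _) <;> rfl

namespace Tree

/-- `mulLetter` in continuation passing style. -/
noncomputable def mulLetterK {α : Type} (x : Bool) (t : Tree) : ℤ → (Tree → α) → α :=
  Tree.rec (fun _ k => k nil)
    (fun z _ _ hl hr e k => force (Int.add z e) fun z' => hl (cond x (.ofNat 0) z) fun l' =>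
      hr (cond x z (.ofNat 0)) fun r' => k (node z' l' r')) t

/-- `mulLetterInv` in continuation passing style. -/
noncomputable def mulLetterInvK {α : Type} (x : Bool) (t : Tree) : ℤ → (Tree → α) → α :=
  Tree.rec (fun _ k => k nil)
    (fun z _ _ hl hr e k => force (Int.sub z e) fun z' => hl (cond x (.ofNat 0) z') fun l' =>
      hr (cond x z' (.ofNat 0)) fun r' => k (node z' l' r')) t

lemma mulLetterK_eq {α : Type} (x : Bool) (t : Tree) (e : ℤ) (k : Tree → α) :
    mulLetterK x t e k = k (mulLetter x e t) := by
  induction t generalizing e k with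
  | nil => rfl
  | node z l r hl hr =>
    refine (force_eq (Int.add z e) fun z' => mulLetterK x l (cond x (.ofNat 0) z) fun l' =>
      mulLetterK x r (cond x z (.ofNat 0)) fun r' => k (node z' l' r')).trans ?_
    exact (hl _ _).trans (hr _ _)

lemma mulLetterInvK_eq {α : Type} (x : Bool) (t : Tree) (e : ℤ) (k : Tree → α) :
    mulLetterInvK x t e k = k (mulLetterInv x e t) := by
  induction t generalizing e k with
  | nil => rfl
  | node z l r hl hr =>
    refine (force_eq (Int.sub z e) fun z' => mulLetterInvK x l (cond x (.ofNat 0) z') fun l' =>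
      mulLetterInvK x r (cond x z' (.ofNat 0)) fun r' => k (node z' l' r')).trans ?_
    exact (hl _ _).trans (hr _ _)

/-- `eval` in continuation passing style. -/
noncomputable def evalK {α : Type} (t : Tree) : List (Bool × Bool) → (Tree → α) → α
  | [], k => k t
  | (x, true) :: L, k => evalK t L fun t' => mulLetterK x t' (.ofNat 0) k
  | (x, false) :: L, k => evalK t L fun t' => mulLetterInvK x t' (.ofNat 0) k

lemma evalK_eq {α : Type} (t : Tree) (L : List (Bool × Bool)) (k : Tree → α) :
    evalK t L k = k (eval t L) := by
  induction L generalizing k with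
  | nil => rfl
  | cons x L ih =>
    obtain ⟨x, s⟩ := x
    cases s with
    | true => exact (ih _).trans (mulLetterK_eq _ _ _ _)
    | false => exact (ih _).trans (mulLetterInvK_eq _ _ _ _)

end Tree

/-- The coefficients at the Lyndon words of lengths five, six and seven. -/
noncomputable def coords (w : FreeGroup Bool) : List ℤ := lyndon.map (coef w)

/-- Tree paths read words from their last letter, hence the reversal. The continuation-passing
evaluator keeps the entries as literals during kernel reduction. -/
noncomputable def checkCoords (L : List (Bool × Bool)) (row : List ℤ) : Bool :=
  oneTree.evalK L fun t => lyndon.map (fun u => t.get u.reverse) == row.map some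

noncomputable def checkAllCoords : List (List (Bool × Bool)) → List (List ℤ) → Bool
  | [], [] => true
  | L :: Ls, row :: rows => checkCoords L row && checkAllCoords Ls rows
  | _, _ => false

/-- The table represents the series 1, the starting point of `Rep.eval`. -/
lemma rep_oneTree : Tree.Rep (Pi.single [] 1) oneTree [] := by
  have h : ∃ l r, oneTree = .node 1 l r ∧ l.isZero = true ∧ r.isZero = true :=
    ⟨_, _, rfl, by decide, by decide⟩
  obtain ⟨l, r, h, hl, hr⟩ := h
  rw [h]
  exact ⟨by simp, .of_isZero hl (by simp), .of_isZero hr (by simp)⟩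

lemma coords_eq_of_check {L : List (Bool × Bool)} {row : List ℤ} (h : checkCoords L row = true) :
    coords (FreeGroup.mk L) = row := by
  rw [checkCoords, Tree.evalK_eq, beq_iff_eq] at h
  have h1 : ∀ (W : List (List Bool)) (row : List ℤ),
      W.map (fun u => (oneTree.eval L).get u.reverse) = row.map some →
      W.map (coef (FreeGroup.mk L)) = row := by
    intro W
    induction W with
    | nil => intro row h; simpa using h.symm
    | cons u W ih =>
      intro row h
      cases row with
      | nil => simp at h
      | cons z row =>
        simp only [List.map_cons, List.cons.injEq] at h ⊢
        refine ⟨?_, ih _ h.2⟩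
        have := (rep_oneTree.eval L).get h.1
        simpa using this
  exact h1 _ _ h

lemma map_coords_eq_of_check {Ls : List (List (Bool × Bool))} {rows : List (List ℤ)}
    (h : checkAllCoords Ls rows = true) :
    Ls.map (fun L => coords (FreeGroup.mk L)) = rows := by
  induction Ls generalizing rows with
  | nil => cases rows with
    | nil => rfl
    | cons _ _ => simp [checkAllCoords] at h
  | cons L Ls ih => cases rows with
    | nil => simp [checkAllCoords] at h
    | cons row rows =>
      simp only [checkAllCoords, Bool.and_eq_true] at h
      rw [List.map_cons, coords_eq_of_check h.1, ih h.2]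

end MagnusRep

/-! ### Integer matrices as lists of rows -/

namespace IntMatrix

open MagnusRep (force force_eq)

/-- `e • xs + ys` for vectors given as lists padded with zeros. -/
noncomputable def addSmul (e : ℤ) : List ℤ → List ℤ → List ℤ
  | [], ys => ys
  | x :: xs, [] => force (Int.mul e x) fun z => z :: addSmul e xs []
  | x :: xs, y :: ys => force (Int.add (Int.mul e x) y) fun z => z :: addSmul e xs ys

/-- The linear combination of `rows` with coefficients `es`. -/
noncomputable def combo : List ℤ → List (List ℤ) → List ℤ
  | e :: es, r :: rs => addSmul e r (combo es rs)
  | _, _ => []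

/-- The product of matrices given as lists of rows. -/
noncomputable def mulRows (A B : List (List ℤ)) : List (List ℤ) := A.map fun es => combo es B

/-- The square matrix with the given rows. -/
def toMatrix (n : ℕ) (A : List (List ℤ)) : Matrix (Fin n) (Fin n) ℤ :=
  Matrix.of fun i j => (A.getD i []).getD j 0

lemma getD_addSmul (e : ℤ) (xs ys : List ℤ) (j : ℕ) :
    (addSmul e xs ys).getD j 0 = e * xs.getD j 0 + ys.getD j 0 := by
  induction xs generalizing ys j with
  | nil => simp [addSmul]
  | cons x xs ih =>
    cases ys with
    | nil => cases j with
      | zero => rw [addSmul, force_eq]; simp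
      | succ j => rw [addSmul, force_eq]; simpa using ih [] j
    | cons y ys => cases j with
      | zero => rw [addSmul, force_eq]; simp
      | succ j => rw [addSmul, force_eq]; simpa using ih ys j

lemma getD_combo (es : List ℤ) (rows : List (List ℤ)) (n j : ℕ) (h : rows.length ≤ n) :
    (combo es rows).getD j 0 = ∑ k ∈ Finset.range n, es.getD k 0 * (rows.getD k []).getD j 0 := by
  induction rows generalizing es n with
  | nil => cases es <;> simp [combo]
  | cons r rs ih =>
    obtain ⟨n, rfl⟩ : ∃ m, n = m + 1 := ⟨n - 1, by simp at h; omega⟩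
    cases es with
    | nil => simp [combo]
    | cons e es =>
      rw [combo, getD_addSmul, ih es n (by simpa using h), Finset.sum_range_succ']
      simp [add_comm]

lemma toMatrix_mulRows (n : ℕ) (A B : List (List ℤ)) (h : B.length ≤ n) :
    toMatrix n (mulRows A B) = toMatrix n A * toMatrix n B := by
  ext i j
  have e : (mulRows A B).getD i [] = combo (A.getD i []) B := by
    rw [mulRows, List.getD_eq_getElem?_getD, List.getElem?_map, List.getD_eq_getElem?_getD]
    cases A[(i : ℕ)]? <;> rfl
  simp only [toMatrix, Matrix.of_apply, Matrix.mul_apply]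
  rw [e, getD_combo _ _ n _ h, Finset.sum_range]

/-- The rows of the scalar matrix of size `n`. -/
def scalarRows (n : ℕ) (c : ℤ) : List (List ℤ) :=
  (List.range n).map fun i => (List.range n).map fun j => if i = j then c else 0

lemma toMatrix_scalarRows (n : ℕ) (c : ℤ) : toMatrix n (scalarRows n c) = c • 1 := by
  ext i j
  simp [toMatrix, scalarRows, List.getD_eq_getElem?_getD, Matrix.one_apply, Fin.ext_iff]

end IntMatrix

/-! ### Words and numerical certificates -/

namespace MagnusRep

open IntMatrix LowerCentral

section Words

variable (x y : List (Bool × Bool))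

/-- A word for the commutator in the convention of Mathlib. -/
def commWord : List (Bool × Bool) := x ++ y ++ FreeGroup.invRev x ++ FreeGroup.invRev y

/-- A word for the Engel commutator. -/
def engelWord : ℕ → List (Bool × Bool)
  | 0 => x
  | n + 1 => FreeGroup.invRev (engelWord n) ++ FreeGroup.invRev y ++ engelWord n ++ y

/-- A word for a conjugate. -/
def conjWord : List (Bool × Bool) := FreeGroup.invRev y ++ x ++ y

lemma mk_commWord : FreeGroup.mk (commWord x y) = ⁅FreeGroup.mk x, FreeGroup.mk y⁆ := by
  simp [mul_assoc, commWord, commutatorElement_def, FreeGroup.inv_mk, ← FreeGroup.mul_mk]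

lemma mk_engelWord (n : ℕ) : FreeGroup.mk (engelWord x y n) =
    EngelGroup.engelComm (FreeGroup.mk x) (FreeGroup.mk y) n := by
  induction n with
  | zero => rfl
  | succ n ih =>
    rw [EngelGroup.engelComm, EngelGroup.comm, ← ih]
    simp [mul_assoc, engelWord, FreeGroup.inv_mk, ← FreeGroup.mul_mk]

lemma mk_conjWord : FreeGroup.mk (conjWord x y) =
    (FreeGroup.mk y)⁻¹ * FreeGroup.mk x * FreeGroup.mk y := by
  simp [mul_assoc, conjWord, FreeGroup.inv_mk, ← FreeGroup.mul_mk]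

end Words

def basisWords : List (List (Bool × Bool)) := basis commWord [(false, true)] [(true, true)]

/-- Words for Engel commutators of the first generator, and for some of their conjugates. -/
def relatorWords : List (List (Bool × Bool)) :=
  let a := (false, true)
  let a' := (false, false)
  let b := (true, true)
  -- Conjugating by words of length at most two brings in commutators of the relators with the
  -- generators, of weights six and seven. There are 4·7 + 2 = 30 = 33 − 3 words.
  ([[b], [a, b], [a', b], [a, a, b]].flatMap fun g =>
    [[], [a], [b], [a, a], [a, b], [b, a], [b, b]].map fun h => conjWord (engelWord [a] g 4) h) ++
    [[a', b, b], [a, b, b]].map fun g => engelWord [a] g 4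

/-- The coordinates of the basic commutators. -/
def basisRows : List (List ℤ) :=
  [[-1, 0, 0, 0, 0, 0, 0, 1, -1, 0, 0, 0, 0, 0, 0, 0, 0, 0, -1, -1, 1, 0, 0, 0, 0, 0, 0, 0, 0, 0,
      0, 0, 0],
    [0, 1, -3, 0, 0, 0, 0, 0, -3, -2, 4, 2, 0, 0, 0, 0, 0, 0, 0, 6, 3, 3, 3, -8, -5, -5, -2, -2,
      0, 2, 0, 0, 0],
    [0, 1, -2, 0, 0, 0, 0, 0, -2, -2, 3, 1, 0, 0, 0, 0, 0, 0, 0, 3, 2, 2, 3, -3, -4, -4, -1, -1,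
      0, 5, 0, 0, 0],
    [0, 0, 0, -1, 2, 0, 0, 0, 0, 0, 2, 0, 3, -5, 0, 0, 0, 0, 0, 0, 0, 0, 0, -3, 0, -4, -2, 0, -6,
      4, 9, 2, 0],
    [0, 0, 0, -1, 3, 0, 0, 0, 0, 0, 1, 0, 3, -9, 0, 0, 0, 0, 0, 0, 0, 0, 0, -1, 0, -3, 1, -1, -6,
      4, 18, -18, 0],
    [0, 0, 0, 0, 0, 1, 0, 0, 0, 0, 0, 0, 0, -1, -4, 0, 0, 0, 0, 0, 0, 0, 0, 0, 0, 0, 0, 0, 0, 0,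
      4, -1, 10],
    [0, 0, 0, 0, 0, 0, 1, 0, 0, 0, 0, 0, 0, 0, 0, 0, -1, 1, 0, 0, 0, 0, 0, 0, 0, 0, 0, 0, 0, 0, 0,
      0, 0],
    [0, 0, 0, 0, 0, 0, 0, -1, 3, 0, 0, 0, 0, 0, 0, 0, 0, 3, 2, -9, -4, -2, 0, 3, 2, 0, 0, 0, 0, 0,
      0, 0, 0],
    [0, 0, 0, 0, 0, 0, 0, -1, 2, 0, 0, 0, 0, 0, 0, 0, 0, 2, 2, -4, -3, -1, 0, -1, 4, 0, 0, 0, 0,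
      0, 0, 0, 0],
    [0, 0, 0, 0, 0, 0, 0, 0, 0, 1, -3, 0, 0, 0, 0, 0, 0, 0, 0, 0, -3, 0, -3, 9, 0, 7, 2, 0, 0, -2,
      0, 0, 0],
    [0, 0, 0, 0, 0, 0, 0, 0, 0, 1, -2, -1, 0, 0, 0, 0, 0, 0, 0, 0, -2, -1, -3, 4, 4, 5, 2, 2, 0,
      -8, 0, 0, 0],
    [0, 0, 0, 0, 0, 0, 0, 0, 0, 1, -2, 0, 0, 0, 0, 0, 0, 0, 0, 0, -2, 0, -3, 4, 0, 5, 1, 0, 0,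
      -11, 0, 0, 0],
    [0, 0, 0, 0, 0, 0, 0, 0, 0, 0, 0, 0, -1, 2, 0, 0, 0, 0, 0, 0, 0, 0, 0, 0, 0, 2, 0, 0, 4, 0,
      -7, -1, 0],
    [0, 0, 0, 0, 0, 0, 0, 0, 0, 0, 0, 0, -1, 3, 0, 0, 0, 0, 0, 0, 0, 0, 0, 0, 0, 1, 0, 1, 4, -2,
      -12, 12, 0],
    [0, 0, 0, 0, 0, 0, 0, 0, 0, 0, 0, 0, 0, 0, 1, 0, 0, 0, 0, 0, 0, 0, 0, 0, 0, 0, 0, 0, 0, 0, -1,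
      0, -5],
    [0, 0, 0, 0, 0, 0, 0, 0, 0, 0, 0, 0, 0, 0, 0, -1, 0, 0, 0, 0, 0, 0, 0, 0, 0, 0, 0, 0, 0, 0, 0,
      0, 0],
    [0, 0, 0, 0, 0, 0, 0, 0, 0, 0, 0, 0, 0, 0, 0, 0, 1, -5, 0, 10, 0, 0, 0, 0, 0, 0, 0, 0, 0, 0,
      0, 0, 0],
    [0, 0, 0, 0, 0, 0, 0, 0, 0, 0, 0, 0, 0, 0, 0, 0, 1, -3, 0, 3, 0, 0, 0, 0, 0, 0, 0, 0, 0, 0, 0,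
      0, 0],
    [0, 0, 0, 0, 0, 0, 0, 0, 0, 0, 0, 0, 0, 0, 0, 0, 0, 0, -1, 0, 3, 1, 0, -3, -3, 0, 0, 0, 0, 0,
      0, 0, 0],
    [0, 0, 0, 0, 0, 0, 0, 0, 0, 0, 0, 0, 0, 0, 0, 0, 1, -2, 0, 0, 0, 0, 0, 0, 0, 0, 0, 0, 0, 0, 0,
      0, 0],
    [0, 0, 0, 0, 0, 0, 0, 0, 0, 0, 0, 0, 0, 0, 0, 0, 0, 0, -1, 0, 2, 2, 0, 0, -6, 0, 0, 0, 0, 0,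
      0, 0, 0],
    [0, 0, 0, 0, 0, 0, 0, 0, 0, 0, 0, 0, 0, 0, 0, 0, 0, 0, -1, 0, 3, 0, 0, -3, 0, 0, 0, 0, 0, 0,
      0, 0, 0],
    [0, 0, 0, 0, 0, 0, 0, 0, 0, 0, 0, 0, 0, 0, 0, 0, 0, 0, 0, 0, 0, 0, 1, 0, 0, -3, 0, 0, 0, 0, 0,
      0, 0],
    [0, 0, 0, 0, 0, 0, 0, 0, 0, 0, 0, 0, 0, 0, 0, 0, 0, 0, -1, 0, 2, 1, 0, 0, -4, 0, 0, 0, 0, 0,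
      0, 0, 0],
    [0, 0, 0, 0, 0, 0, 0, 0, 0, 0, 0, 0, 0, 0, 0, 0, 0, 0, 0, 0, 0, 0, 1, 0, 0, -2, -1, 0, 0, 4,
      0, 0, 0],
    [0, 0, 0, 0, 0, 0, 0, 0, 0, 0, 0, 0, 0, 0, 0, 0, 0, 0, -1, 0, 2, 0, 0, 1, -4, 0, 0, 0, 0, 0,
      0, 0, 0],
    [0, 0, 0, 0, 0, 0, 0, 0, 0, 0, 0, 0, 0, 0, 0, 0, 0, 0, 0, 0, 0, 0, 1, 0, 0, -2, 0, -1, 0, 4,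
      0, 0, 0],
    [0, 0, 0, 0, 0, 0, 0, 0, 0, 0, 0, 0, 0, 0, 0, 0, 0, 0, 0, 0, 0, 0, 1, 0, 0, -2, 0, 0, 0, 6, 0,
      0, 0],
    [0, 0, 0, 0, 0, 0, 0, 0, 0, 0, 0, 0, 0, 0, 0, 0, 0, 0, 0, 0, 0, 0, 0, 0, 0, 0, 0, 0, -1, 0, 2,
      0, 0],
    [0, 0, 0, 0, 0, 0, 0, 0, 0, 0, 0, 0, 0, 0, 0, 0, 0, 0, 0, 0, 0, 0, 1, 0, 0, -3, 3, -2, 0, 3,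
      0, 0, 0],
    [0, 0, 0, 0, 0, 0, 0, 0, 0, 0, 0, 0, 0, 0, 0, 0, 0, 0, 0, 0, 0, 0, 0, 0, 0, 0, 0, 0, -1, 0, 3,
      -3, 0],
    [0, 0, 0, 0, 0, 0, 0, 0, 0, 0, 0, 0, 0, 0, 0, 0, 0, 0, 0, 0, 0, 0, 0, 0, 0, 0, 0, 0, -1, 0, 5,
      -10, 0],
    [0, 0, 0, 0, 0, 0, 0, 0, 0, 0, 0, 0, 0, 0, 0, 0, 0, 0, 0, 0, 0, 0, 0, 0, 0, 0, 0, 0, 0, 0, 0,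
      0, 1]]

/-- The inverse of the matrix of coordinates of the basic commutators. -/
def basisInv : List (List ℤ) :=
  [[-1, 0, 0, 0, 0, 0, 0, 1, -2, 0, 0, 0, 0, 0, 0, 0, 3, -10, 2, 7, -2, -1, 0, 2, 0, -2, 0, 0, 0,
      0, 0, 0, 0],
    [0, -2, 3, 0, 0, 0, 0, 0, 0, -3, -1, 6, 0, 0, 0, 0, 3, -9, -8, 6, 11, 9, 1, -15, -16, 3, 9,
      14, 0, -5, 0, 0, 0],
    [0, -1, 1, 0, 0, 0, 0, -1, 1, -1, -1, 2, 0, 0, 0, 0, 1, -4, -3, 3, 2, 2, 0, -2, -4, 1, 1, 4,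
      0, -1, 0, 0, 0],
    [0, 0, 0, -3, 2, 0, 0, 0, 0, -4, 0, 4, -12, 9, 0, 0, 0, 0, -10, 0, 7, 6, 5, -4, -62, 1, 51,
      28, -39, -22, 36, -3, 0],
    [0, 0, 0, -1, 1, 0, 0, 0, 0, -1, 0, 1, -4, 4, 0, 0, 0, 0, -2, 0, 1, 1, -2, 0, -7, 0, 9, 3,
      -13, -3, 14, -1, 0],
    [0, 0, 0, 0, 0, 1, 0, 0, 0, 0, 0, 0, -1, 1, 4, 0, 0, 0, 0, 0, 0, 0, 1, 0, -6, 0, 5, 2, -11,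
      -2, 14, -3, 10],
    [0, 0, 0, 0, 0, 0, 1, 0, 0, 0, 0, 0, 0, 0, 0, 0, 3, -10, 0, 8, 0, 0, 0, 0, 0, 0, 0, 0, 0, 0,
      0, 0, 0],
    [0, 0, 0, 0, 0, 0, 0, 2, -3, 0, 0, 0, 0, 0, 0, 0, 6, -18, 0, 12, 6, 3, 0, -11, 0, 0, 0, 0, 0,
      0, 0, 0, 0],
    [0, 0, 0, 0, 0, 0, 0, 1, -1, 0, 0, 0, 0, 0, 0, 0, 2, -5, 0, 3, 1, 1, 0, -1, 0, -1, 0, 0, 0, 0,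
      0, 0, 0],
    [0, 0, 0, 0, 0, 0, 0, 0, 0, -2, 0, 3, 0, 0, 0, 0, 0, 0, -12, 0, 18, 12, 16, -24, -64, 6, 42,
      30, 0, -21, 0, 0, 0],
    [0, 0, 0, 0, 0, 0, 0, 0, 0, -1, 0, 1, 0, 0, 0, 0, 0, 0, -6, 0, 7, 5, 3, -8, -16, 2, 10, 8, 0,
      -5, 0, 0, 0],
    [0, 0, 0, 0, 0, 0, 0, 0, 0, 0, -1, 1, 0, 0, 0, 0, 0, 0, -2, 0, 1, 2, 3, -1, -10, 0, 4, 6, 0,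
      -3, 0, 0, 0],
    [0, 0, 0, 0, 0, 0, 0, 0, 0, 0, 0, 0, -3, 2, 0, 0, 0, 0, 0, 0, 0, 0, 12, 0, -48, 0, 34, 18,
      -27, -16, 29, -6, 0],
    [0, 0, 0, 0, 0, 0, 0, 0, 0, 0, 0, 0, -1, 1, 0, 0, 0, 0, 0, 0, 0, 0, 1, 0, -6, 0, 5, 2, -9, -2,
      11, -2, 0],
    [0, 0, 0, 0, 0, 0, 0, 0, 0, 0, 0, 0, 0, 0, 1, 0, 0, 0, 0, 0, 0, 0, 0, 0, 0, 0, 0, 0, -7, 0,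
      10, -3, 5],
    [0, 0, 0, 0, 0, 0, 0, 0, 0, 0, 0, 0, 0, 0, 0, -1, 0, 0, 0, 0, 0, 0, 0, 0, 0, 0, 0, 0, 0, 0, 0,
      0, 0],
    [0, 0, 0, 0, 0, 0, 0, 0, 0, 0, 0, 0, 0, 0, 0, 0, 6, -20, 0, 15, 0, 0, 0, 0, 0, 0, 0, 0, 0, 0,
      0, 0, 0],
    [0, 0, 0, 0, 0, 0, 0, 0, 0, 0, 0, 0, 0, 0, 0, 0, 3, -10, 0, 7, 0, 0, 0, 0, 0, 0, 0, 0, 0, 0,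
      0, 0, 0],
    [0, 0, 0, 0, 0, 0, 0, 0, 0, 0, 0, 0, 0, 0, 0, 0, 0, 0, -6, 0, 15, 8, 0, -24, 0, 6, 0, 0, 0, 0,
      0, 0, 0],
    [0, 0, 0, 0, 0, 0, 0, 0, 0, 0, 0, 0, 0, 0, 0, 0, 1, -3, 0, 2, 0, 0, 0, 0, 0, 0, 0, 0, 0, 0, 0,
      0, 0],
    [0, 0, 0, 0, 0, 0, 0, 0, 0, 0, 0, 0, 0, 0, 0, 0, 0, 0, -4, 0, 8, 5, 0, -12, 0, 3, 0, 0, 0, 0,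
      0, 0, 0],
    [0, 0, 0, 0, 0, 0, 0, 0, 0, 0, 0, 0, 0, 0, 0, 0, 0, 0, -2, 0, 3, 2, 0, -3, 0, 0, 0, 0, 0, 0,
      0, 0, 0],
    [0, 0, 0, 0, 0, 0, 0, 0, 0, 0, 0, 0, 0, 0, 0, 0, 0, 0, 0, 0, 0, 0, 16, 0, -54, 0, 36, 21, 0,
      -18, 0, 0, 0],
    [0, 0, 0, 0, 0, 0, 0, 0, 0, 0, 0, 0, 0, 0, 0, 0, 0, 0, -2, 0, 3, 2, 0, -4, 0, 1, 0, 0, 0, 0,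
      0, 0, 0],
    [0, 0, 0, 0, 0, 0, 0, 0, 0, 0, 0, 0, 0, 0, 0, 0, 0, 0, -1, 0, 1, 1, 0, -1, 0, 0, 0, 0, 0, 0,
      0, 0, 0],
    [0, 0, 0, 0, 0, 0, 0, 0, 0, 0, 0, 0, 0, 0, 0, 0, 0, 0, 0, 0, 0, 0, 5, 0, -18, 0, 12, 7, 0, -6,
      0, 0, 0],
    [0, 0, 0, 0, 0, 0, 0, 0, 0, 0, 0, 0, 0, 0, 0, 0, 0, 0, 0, 0, 0, 0, 2, 0, -7, 0, 4, 3, 0, -2,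
      0, 0, 0],
    [0, 0, 0, 0, 0, 0, 0, 0, 0, 0, 0, 0, 0, 0, 0, 0, 0, 0, 0, 0, 0, 0, 2, 0, -6, 0, 3, 3, 0, -2,
      0, 0, 0],
    [0, 0, 0, 0, 0, 0, 0, 0, 0, 0, 0, 0, 0, 0, 0, 0, 0, 0, 0, 0, 0, 0, 0, 0, 0, 0, 0, 0, -15, 0,
      20, -6, 0],
    [0, 0, 0, 0, 0, 0, 0, 0, 0, 0, 0, 0, 0, 0, 0, 0, 0, 0, 0, 0, 0, 0, -1, 0, 3, 0, -2, -1, 0, 1,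
      0, 0, 0],
    [0, 0, 0, 0, 0, 0, 0, 0, 0, 0, 0, 0, 0, 0, 0, 0, 0, 0, 0, 0, 0, 0, 0, 0, 0, 0, 0, 0, -7, 0,
      10, -3, 0],
    [0, 0, 0, 0, 0, 0, 0, 0, 0, 0, 0, 0, 0, 0, 0, 0, 0, 0, 0, 0, 0, 0, 0, 0, 0, 0, 0, 0, -2, 0, 3,
      -1, 0],
    [0, 0, 0, 0, 0, 0, 0, 0, 0, 0, 0, 0, 0, 0, 0, 0, 0, 0, 0, 0, 0, 0, 0, 0, 0, 0, 0, 0, 0, 0, 0,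
      0, 1]]

/-- The coordinates of the relators. -/
def relatorRows : List (List ℤ) :=
  [[0, 0, 0, 0, 0, 1, 0, 0, 0, 0, 0, 0, -1, 1, 0, 0, 0, 0, 0, 0, 0, 0, 1, 0, 0, -1, 0, 0, 0, 0,
      0, 1, 0],
    [0, 0, 0, 0, 0, 1, 0, 0, 0, 0, 0, 0, -2, 5, 0, 0, 0, 0, 0, 0, 0, 0, 3, 0, 0, -6, 6, -4, 0, 3,
      4, -15, 0],
    [0, 0, 0, 0, 0, 1, 0, 0, 0, 0, 0, 0, -1, 1, 1, 0, 0, 0, 0, 0, 0, 0, 1, 0, 0, -1, 0, 0, -1, 0,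
      1, 1, 0],
    [0, 0, 0, 0, 0, 1, 0, 0, 0, 0, 0, 0, -3, 9, 0, 0, 0, 0, 0, 0, 0, 0, 6, 0, 0, -15, 18, -12, 0,
      6, 8, -31, 0],
    [0, 0, 0, 0, 0, 1, 0, 0, 0, 0, 0, 0, -2, 5, 1, 0, 0, 0, 0, 0, 0, 0, 3, 0, 0, -6, 6, -4, -2, 3,
      9, -21, 0],
    [0, 0, 0, 0, 0, 1, 0, 0, 0, 0, 0, 0, -2, 5, 1, 0, 0, 0, 0, 0, 0, 0, 3, 0, 0, -6, 6, -4, -2, 3,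
      10, -25, 0],
    [0, 0, 0, 0, 0, 1, 0, 0, 0, 0, 0, 0, -1, 1, 2, 0, 0, 0, 0, 0, 0, 0, 1, 0, 0, -1, 0, 0, -2, 0,
      2, 1, 1],
    [-1, 3, -7, -3, 7, 1, 4, -12, 30, 12, -28, 5, -4, 14, 0, -10, 30, -79, -30, 60, 72, -3, 10,
      -12, -80, -33, 31, -26, 0, 49, 6, -23, 0],
    [-1, 3, -7, -3, 7, 1, 5, -15, 37, 15, -35, 8, -5, 18, 0, -15, 45, -116, -45, 82, 107, -11, 15,
      -9, -120, -51, 54, -43, 0, 78, 10, -39, 0],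
    [-1, 3, -7, -3, 7, 1, 4, -13, 34, 15, -35, 3, -7, 21, 1, -10, 34, -95, -42, 84, 102, 6, 22,
      -31, -111, -61, 36, -33, -4, 81, 20, -40, 0],
    [-1, 3, -7, -3, 7, 1, 6, -18, 44, 18, -42, 11, -6, 22, 0, -21, 63, -160, -63, 107, 149, -22,
      21, -4, -168, -73, 83, -64, 0, 107, 14, -55, 0],
    [-1, 3, -7, -3, 7, 1, 5, -16, 41, 18, -42, 6, -8, 25, 1, -15, 50, -137, -60, 116, 144, 3, 30,
      -31, -166, -86, 62, -55, -5, 118, 28, -62, 0],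
    [-1, 3, -7, -3, 7, 1, 5, -16, 41, 18, -42, 6, -8, 25, 1, -15, 50, -136, -60, 112, 144, 0, 30,
      -31, -159, -86, 62, -52, -5, 125, 29, -66, 0],
    [-1, 3, -7, -3, 7, 1, 4, -14, 38, 18, -42, 1, -10, 28, 2, -10, 38, -111, -55, 108, 136, 15,
      37, -56, -142, -96, 39, -40, -11, 121, 41, -60, 1],
    [1, 3, -7, 3, -7, 1, -1, 0, -7, 3, -14, 3, 2, -12, 0, 1, 0, 1, 0, 9, -5, -1, 1, 10, 25, -11,
      17, -16, 0, 25, -6, 25, 0],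
    [1, 3, -7, 3, -7, 1, -2, -3, 0, 0, -7, 0, 1, -8, 0, 3, 3, 1, 0, -2, 2, -1, 0, 4, 9, -3, 6, -7,
      0, 2, -2, 9, 0],
    [1, 3, -7, 3, -7, 1, -1, 1, -11, 6, -21, 1, 5, -19, 1, 1, -1, 2, 0, 15, -12, -3, 4, 24, 39,
      -25, 20, -20, 2, 49, -18, 42, 0],
    [1, 3, -7, 3, -7, 1, -3, -6, 7, -3, 0, -3, 0, -4, 0, 6, 9, -6, 3, -10, 2, 2, 0, -4, 1, 1, 1,
      -2, 0, -21, 2, -7, 0],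
    [1, 3, -7, 3, -7, 1, -2, -2, -4, 3, -14, -2, 4, -15, 1, 3, 1, 7, -3, -6, 2, 2, 0, 15, 8, -10,
      6, -6, 1, 18, -10, 20, 0],
    [1, 3, -7, 3, -7, 1, -2, -2, -4, 3, -14, -2, 4, -15, 1, 3, 1, 6, -3, -2, 2, -1, 0, 15, 15,
      -10, 6, -9, 1, 11, -9, 16, 0],
    [1, 3, -7, 3, -7, 1, -1, 2, -15, 9, -28, -1, 8, -26, 2, 1, -2, 3, 1, 21, -23, -5, 10, 44, 53,
      -46, 21, -24, 7, 81, -37, 62, 1],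
    [-8, 12, -28, -6, 14, 1, 44, -72, 194, 39, -98, 18, -7, 27, 0, -146, 255, -762, -147, 721,
      397, -14, 28, -98, -515, -107, 110, -94, 0, 172, 12, -47, 0],
    [-8, 12, -28, -6, 14, 1, 52, -84, 222, 45, -112, 24, -8, 31, 0, -198, 339, -984, -192, 875,
      509, -38, 36, -95, -651, -138, 150, -124, 0, 227, 16, -63, 0],
    [-8, 12, -28, -6, 14, 1, 44, -80, 226, 51, -126, 10, -13, 41, 1, -146, 299, -950, -219, 1033,
      591, 44, 67, -240, -729, -205, 128, -119, -7, 292, 39, -81, 0],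
    [-8, 12, -28, -6, 14, 1, 60, -96, 250, 51, -126, 30, -9, 35, 0, -258, 435, -1234, -243, 1041,
      635, -68, 45, -88, -803, -173, 196, -158, 0, 282, 20, -79, 0],
    [-8, 12, -28, -6, 14, 1, 52, -92, 254, 57, -140, 16, -14, 45, 1, -198, 391, -1212, -276, 1267,
      731, 40, 81, -249, -925, -250, 174, -159, -8, 363, 47, -103, 0],
    [-8, 12, -28, -6, 14, 1, 52, -92, 254, 57, -140, 16, -14, 45, 1, -198, 391, -1204, -276, 1235,
      731, 28, 81, -249, -897, -250, 174, -153, -8, 377, 48, -107, 0],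
    [-8, 12, -28, -6, 14, 1, 44, -88, 258, 63, -154, 2, -19, 55, 2, -146, 343, -1138, -299, 1345,
      817, 102, 118, -430, -943, -331, 138, -144, -20, 444, 80, -121, 1],
    [2, 12, -28, 24, -56, 16, -2, 1, -28, 36, -126, 10, 68, -248, 32, 2, -1, 4, 0, 36, -54, -22,
      55, 108, 200, -288, 221, -232, 82, 496, -494, 948, 24],
    [-2, 12, -28, -24, 56, 16, 8, -49, 120, 108, -238, 26, -100, 280, 32, -20, 124, -316, -288,
      240, 636, 36, 307, -134, -640, -752, 397, -376, -146, 912, 542, -868, 24]]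

/-- Vectors completing the coordinates of the relators to a basis over the rationals. -/
def complementRows : List (List ℤ) :=
  [[0, 0, 0, 1800, -3600, 0, 0, 0, 0, 0, -1800, 0, 0, 0, 0, 0, 0, 0, 0, 0, 0, 0, 0, 0, 0, 0, 0,
      0, 0, 0, 0, 0, 0],
    [0, 1800, -3600, -5400, 12600, 0, 0, 0, 0, 1800, 0, 0, 0, 0, 0, 0, 0, 0, 0, 0, 0, 0, 0, 0, 0,
      0, 0, 0, 0, 0, 0, 0, 0],
    [0, 1800, -3600, 0, 0, 0, 0, 0, 0, 0, -1800, 0, 0, 0, 0, 0, 0, 0, 0, 0, 0, 0, 0, 0, 0, 0, 0,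
      0, 0, 0, 0, 0, 0]]

set_option maxHeartbeats 1000000 in
/-- The inverse, up to a scalar factor, of the matrix of coordinates of the relators. -/
def relatorInv : List (List ℤ) :=
  [[5763, 33867, -109833, -54939, 166269, -30048, -21519, 61947, -103338, 11484, 59244, -92892,
      49932, 36783, -4823, 9844, 6642, -4158, -22218, 15260, -9787, -24727, 48179, -11325, -26859,
      32793, -16064, -5477, 1590, -1590, 0, 0, 0],
    [-492579, 528390, 769518, -101799, -743022, 117900, -287568, -174024, 34290, 307368, 9576,
      209016, -263628, -324558, 137010, -201870, -147120, 64206, 198240, -55572, 22746, 4713,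
      -19098, 41802, 25425, -132522, 69540, 32100, 630, 22590, 0, 0, 7],
    [-482139, 2170539, -2530521, -2252709, 4142493, -469584, -1609839, 697779, -2616966, 2153268,
      1958400, -2944368, 697824, 294903, 40173, -77184, -30942, -5094, -193062, 307224, -352875,
      -419109, 1168803, -601605, -761373, 876297, -249264, -68829, 64170, 8190, 0, 3, 0],
    [470247, -1771488, 1804704, 1747983, -3040248, 336300, 1275102, -538254, 2035854, -1679976,
      -1511952, 2214120, -497700, -176292, -54544, 91250, 47028, -6438, 115212, -223676, 265768,
      325015, -895616, 448596, 578823, -648156, 182036, 48062, -49110, -9750, 7, 0, 0],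
    [-726, 1020600, -2012928, -1327818, 2993880, -360384, -828504, 515664, -1616184, 1159596,
      1197636, -1941816, 580788, 369036, -55604, 69376, 66132, -40416, -234576, 223172, -231364,
      -258958, 730544, -398208, -484674, 618480, -193016, -60848, 39300, -7980, 3, 3, -3],
    [-20997, 45090, -8766, -32625, 39006, -10116, -29232, 8028, -36126, 33300, 25596, -27972, 756,
      -6822, 5874, -8046, -6492, 1998, 4356, 2124, -3054, -6081, 14850, -5298, -8721, 6066, -1044,
      228, 810, 810, 0, 0, 0],
    [-9900, 14850, 4050, -4950, 2700, -6750, 0, 10350, -15750, -4050, 5400, -2700, 6750, 0, 3150,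
      -4650, -1350, 1500, -900, 2250, 0, -3600, 5550, 1350, -1950, 900, -2250, 0, 0, 0, 0, 0, 0],
    [-109836, -4050, 389502, 134604, -479718, 47520, 50058, -67086, 175896, -109944, -137016,
      269784, -102168, -94986, 37410, -49404, -38316, 17568, 60156, -32568, 33234, 27192, -88746,
      62022, 63468, -97326, 31056, 11694, -4680, 4680, 0, 0, 0],
    [-23850, 1188, 78012, 25632, -91530, 7038, 8910, -10224, 32130, -24462, -26316, 51660, -17838,
      -17550, 8148, -10302, -8334, 3564, 11160, -5466, 6630, 4326, -16536, 13104, 12240, -18810,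
      5466, 2010, -900, 900, 0, 0, 0],
    [944124, -8645976, 13674048, 10135056, -21049896, 2474520, 6692724, -3654828, 12152628,
      -9157932, -9012084, 14137320, -3899340, -2197764, 168932, -164380, -236604, 189204, 1403304,
      -1563212, 1688356, 1944820, -5443952, 2888232, 3581016, -4388712, 1329152, 400364, -294720,
      20400, 0, -14, 14],
    [471699, -3812688, 5830560, 4403619, -9028008, 1057068, 2932110, -1569582, 5268222, -3999168,
      -3907224, 6097752, -1659276, -914364, 56664, -47502, -85236, 74394, 584364, -670020, 728496,
      842931, -2356704, 1245012, 1548171, -1885116, 568068, 169758, -127710, 6210, 0, -6, 6],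
    [-79911, 97956, 90036, -35271, -66744, 10800, -54666, -10134, -25542, 55080, 20484, 3492,
      -28008, -40572, 21516, -29322, -22860, 8898, 25584, -4728, 912, -3831, 7884, 1728, -2967,
      -10716, 6816, 3606, 630, 3150, 0, 0, 0],
    [-223830, 436068, -61308, -304614, 280008, -34668, -277416, 59796, -334044, 331992, 244584,
      -281016, 9792, -62064, 49800, -71724, -51576, 19092, 37320, 19440, -33312, -53454, 137820,
      -54372, -83334, 62472, -10404, 1272, 7740, 7740, 0, 0, 0],
    [-23985, 46602, -7182, -32481, 34362, -7632, -29124, 6444, -35046, 34668, 25596, -29124, 828,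
      -6606, 5490, -7686, -5844, 1998, 4020, 2100, -3318, -5661, 14490, -5658, -8721, 6438, -1056,
      168, 810, 810, 0, 0, 0],
    [3960, -4680, -5040, 0, 10080, -5400, 1080, -2160, 0, 4320, 0, 0, 0, -2160, 720, 0, -1440, 0,
      0, 0, 720, 360, 0, -720, 0, 0, 0, 360, 0, 0, 0, 0, 0],
    [-900, 1800, 0, -900, 0, 0, 0, 900, -1800, 0, 900, 0, 0, 0, 300, -600, 0, 300, 0, 0, 0, -300,
      600, 0, -300, 0, 0, 0, 0, 0, 0, 0, 0],
    [-8100, 11700, 4500, -3600, 5400, -9900, 0, 6300, -8100, -4500, 1800, -5400, 9900, 0, 3300,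
      -5100, -1500, 1800, -1800, 3300, 0, -1500, 1500, 1500, 0, 1800, -3300, 0, 0, 0, 0, 0, 0],
    [-3600, 5040, 2160, -1440, 2700, -4860, 0, 2880, -3600, -2160, 720, -2700, 4860, 0, 1440,
      -2160, -720, 720, -900, 1620, 0, -720, 720, 720, 0, 900, -1620, 0, 0, 0, 0, 0, 0],
    [-237348, -67536, 982872, 368568, -1264464, 154224, 137124, -221220, 507888, -249048, -369936,
      711792, -296208, -254628, 81924, -111408, -89160, 40896, 161808, -95472, 84852, 82884,
      -240816, 148488, 166104, -255408, 90576, 32652, -12240, 12240, 0, 0, 0],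
    [-900, 1260, 540, -360, 900, -1440, 0, 720, -900, -540, 180, -900, 1440, 0, 360, -540, -180,
      180, -300, 480, 0, -180, 180, 180, 0, 300, -480, 0, 0, 0, 0, 0, 0],
    [-133308, -37296, 550152, 206028, -706104, 85104, 76464, -123300, 283788, -139788, -206856,
      397512, -164988, -142128, 46164, -62628, -50220, 22896, 90168, -52812, 47472, 46284,
      -134616, 83088, 92844, -142728, 50616, 18192, -6840, 6840, 0, 0, 0],
    [-49644, -13608, 203616, 76104, -259992, 30672, 27972, -45360, 105084, -52164, -76608, 146376,
      -60444, -52164, 17472, -23604, -18900, 8568, 33144, -19116, 17556, 17052, -49728, 30744,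
      34272, -52584, 18648, 6636, -2520, 2520, 0, 0, 0],
    [-262260, 509040, -65520, -352620, 299520, -22320, -321840, 67320, -387000, 387360, 284400,
      -329040, 12240, -71280, 55920, -82200, -56640, 22200, 42480, 22320, -40080, -61500, 159600,
      -63600, -96900, 73440, -12240, 1200, 9000, 9000, 0, 0, 0],
    [-49464, -13608, 203256, 75924, -259992, 31032, 27972, -45180, 104544, -51984, -76248, 146376,
      -60624, -52164, 17172, -23184, -18720, 8448, 33144, -19296, 17556, 16992, -49608, 30744,
      34212, -52584, 18648, 6636, -2520, 2520, 0, 0, 0],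
    [-21276, -5832, 87264, 32616, -111168, 12888, 11988, -19440, 45036, -22356, -32832, 62604,
      -25776, -22356, 7488, -10116, -8100, 3672, 14076, -8064, 7524, 7308, -21312, 13176, 14688,
      -22536, 7992, 2844, -1080, 1080, 0, 0, 0],
    [-83952, 163584, -21600, -113112, 95760, -7200, -102600, 21636, -124128, 124056, 91008,
      -105120, 4032, -23004, 17604, -26208, -17640, 7104, 13536, 7104, -13020, -19728, 51120,
      -20304, -31008, 23472, -3936, 384, 2880, 2880, 0, 0, 0],
    [-36234, 70488, -9360, -49014, 42120, -3240, -45000, 9252, -54036, 54432, 39816, -46440, 1944,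
      -10008, 7848, -11556, -7920, 3108, 6072, 3048, -5640, -8586, 22320, -8928, -13566, 10344,
      -1752, 168, 1260, 1260, 0, 0, 0],
    [-36414, 70308, -8820, -49014, 42300, -3240, -45360, 9072, -53676, 54432, 39816, -46800, 1944,
      -9828, 8148, -11676, -8400, 3108, 6192, 3048, -5460, -8526, 22260, -8988, -13566, 10404,
      -1752, 168, 1260, 1260, 0, 0, 0],
    [10800, -9000, -12600, 0, 19800, -10800, 1800, -3600, 0, 7200, 0, 0, 0, -3600, 1200, 0, -2400,
      0, 0, 0, 1200, 600, 0, -1200, 0, 0, 0, 600, 0, 0, 0, 0, 0],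
    [15606, -30132, 3780, 21006, -18000, 1260, 19440, -3888, 23004, -23328, -17064, 19800, -576,
      4212, -3492, 5004, 3600, -1332, -2568, -1392, 2340, 3654, -9540, 3852, 5814, -4416, 708,
      -72, -540, -540, 0, 0, 0],
    [5040, -4320, -5760, 0, 9720, -5400, 720, -1440, 0, 2880, 0, 0, 0, -1440, 480, 0, -960, 0, 0,
      0, 480, 240, 0, -480, 0, 0, 0, 240, 0, 0, 0, 0, 0],
    [1260, -1080, -1440, 0, 2880, -1800, 180, -360, 0, 720, 0, 0, 0, -360, 120, 0, -240, 0, 0, 0,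
      120, 60, 0, -120, 0, 0, 0, 60, 0, 0, 0, 0, 0],
    [1800, 0, -3600, 0, 0, 0, 1800, 0, 0, 0, 0, 0, 0, 0, 0, 0, 0, 0, 0, 0, 0, 0, 0, 0, 0, 0, 0, 0,
      0, 0, 0, 0, 0]]

lemma check_basis : checkAllCoords basisWords basisRows = true := by decide +kernel

lemma check_relators : checkAllCoords relatorWords relatorRows = true := by decide +kernel

lemma basis_mul_inv : mulRows basisRows basisInv = scalarRows 33 1 := by decide +kernel

/-- Each complementary row has value 1800 under one functional of `Balanced` and 0 under the other
two, so the last three columns of `relatorInv` are these functionals. The other thirty columns give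
the exponents of the relators. -/
lemma relator_inv_mul :
    mulRows relatorInv (relatorRows ++ complementRows) = scalarRows 33 1800 := by decide +kernel

end MagnusRep

/-! ### Coordinates on γ_5/γ_8, and powers lying in the normal closure -/

namespace MagnusRep

open IntMatrix LowerCentral

lemma closure_generators :
    Subgroup.closure {FreeGroup.of false, FreeGroup.of true} = (⊤ : Subgroup (FreeGroup Bool)) := by
  rw [← FreeGroup.closure_range_of Bool]
  congr 1
  ext x
  simp

/-- The vector of coefficients at the Lyndon words of lengths five, six and seven. -/
noncomputable def cvec (w : FreeGroup Bool) : Fin 33 → ℤ := fun i => coef w (lyndon.getD i [])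

lemma lyndon_length (i : Fin 33) :
    5 ≤ (lyndon.getD i []).length ∧ (lyndon.getD i []).length ≤ 7 := by
  revert i; decide

lemma getD_coords (w : FreeGroup Bool) (i : Fin 33) : (coords w).getD i 0 = cvec w i := by
  have h : (i : ℕ) < lyndon.length := i.2
  have h' : (i : ℕ) < (lyndon.map (coef w)).length := by simpa using h
  rw [coords, cvec, List.getD_eq_getElem _ _ h, List.getD_eq_getElem _ _ h', List.getElem_map]

lemma cvec_mul {w z : FreeGroup Bool} (hw : w ∈ gam (FreeGroup Bool) 5)
    (hz : z ∈ gam (FreeGroup Bool) 5) : cvec (w * z) = cvec w + cvec z := by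
  funext i
  have h := lyndon_length i
  refine coef_mul_of_mem_filt (gam_le_filt 5 hw) (gam_le_filt 5 hz) (by omega) ?_
  intro h0
  rw [h0] at h
  simp at h

lemma cvec_eq_zero {w : FreeGroup Bool} {n : ℕ} (hw : w ∈ gam (FreeGroup Bool) n) (i : Fin 33)
    (hi : (lyndon.getD i []).length < n) : cvec w i = 0 := by
  have h := lyndon_length i
  refine coef_eq_zero (gam_le_filt n hw) hi ?_
  intro h0
  rw [h0] at h
  simp at h

/-- The fifth term of the lower central series of the free group of rank two. -/
abbrev Gam5 : Type := gam (FreeGroup Bool) 5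

/-- The coordinates as a homomorphism. -/
noncomputable def cvecHom : Gam5 →* Multiplicative (Fin 33 → ℤ) :=
  MonoidHom.mk' (fun w => Multiplicative.ofAdd (cvec w)) fun w z => by
    rw [← ofAdd_add, ← cvec_mul w.2 z.2]; rfl

abbrev Gam8In : Subgroup Gam5 := (gam (FreeGroup Bool) 8).subgroupOf (gam (FreeGroup Bool) 5)

/-- Commutators of elements of γ_5 lie in γ_10, hence in γ_8. -/
instance : CommGroup (Gam5 ⧸ Gam8In) :=
  { (inferInstance : Group (Gam5 ⧸ Gam8In)) with
    mul_comm := by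
      rintro ⟨x⟩ ⟨y⟩
      refine QuotientGroup.eq.2 ?_
      rw [Subgroup.mem_subgroupOf]
      have : ((x * y)⁻¹ * (y * x) : Gam5) = ⁅y⁻¹, x⁻¹⁆ := by
        rw [commutatorElement_def]; group
      rw [this]
      exact comm_mem_gam (i := 5) (j := 5) (y⁻¹).2 (x⁻¹).2 (by norm_num) }

lemma basis_eq_map : basis gbr (FreeGroup.of false) (FreeGroup.of true) =
    basisWords.map FreeGroup.mk :=
  (map_basis commWord _ _ gbr FreeGroup.mk mk_commWord).symm

lemma basisWords_length : basisWords.length = 33 := rfl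

/-- The basic commutators of weights five, six and seven. -/
noncomputable def basisElt (i : Fin 33) : Gam5 :=
  ⟨FreeGroup.mk (basisWords.get (i.cast basisWords_length.symm)),
    mem_gam_five_of_mem_basis (a := FreeGroup.of false) (b := FreeGroup.of true) (by
      rw [basis_eq_map]
      exact List.mem_map_of_mem (List.get_mem _ _))⟩

lemma cvec_eq_of_map_eq {Ls : List (List (Bool × Bool))} {rows : List (List ℤ)}
    (h : Ls.map (fun L => coords (FreeGroup.mk L)) = rows) {i : ℕ} (hi : i < Ls.length)
    (j : Fin 33) : cvec (FreeGroup.mk Ls[i]) j = (rows.getD i []).getD j 0 := by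
  subst h
  have h' : i < (Ls.map fun L => coords (FreeGroup.mk L)).length := by rwa [List.length_map]
  rw [List.getD_eq_getElem _ _ h', List.getElem_map, getD_coords]

lemma cvec_basisElt (i : Fin 33) : cvec (basisElt i) = toMatrix 33 basisRows i := by
  funext j
  exact cvec_eq_of_map_eq (map_coords_eq_of_check check_basis) _ j

lemma toMatrix_basis_mul : toMatrix 33 basisRows * toMatrix 33 basisInv = 1 := by
  rw [← toMatrix_mulRows 33 _ _ (by decide), basis_mul_inv, toMatrix_scalarRows, one_smul]

/-- The reconstruction of an element of `Gam5` modulo `gam 8` from its coordinates. -/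
noncomputable def rebuild : Gam5 →* Gam5 ⧸ Gam8In :=
  MonoidHom.mk' (fun w => ∏ i, (basisElt i : Gam5 ⧸ Gam8In) ^
      (Matrix.vecMul (cvec w) (toMatrix 33 basisInv)) i) fun w z => by
    rw [← Finset.prod_mul_distrib]
    refine Finset.prod_congr rfl fun i _ => ?_
    rw [← zpow_add, Subgroup.coe_mul, cvec_mul w.2 z.2, Matrix.add_vecMul, Pi.add_apply]

lemma rebuild_apply (w : Gam5) : rebuild w = ∏ i, (basisElt i : Gam5 ⧸ Gam8In) ^
    (Matrix.vecMul (cvec w) (toMatrix 33 basisInv)) i := rfl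

lemma rebuild_eq_one {w : Gam5} (h : cvec w = 0) : rebuild w = 1 := by
  rw [rebuild_apply, h, Matrix.zero_vecMul]
  simp

lemma rebuild_basisElt (i : Fin 33) : rebuild (basisElt i) = (basisElt i : Gam5 ⧸ Gam8In) := by
  have h : Matrix.vecMul (cvec (basisElt i)) (toMatrix 33 basisInv) = (1 : Matrix _ _ ℤ) i := by
    rw [cvec_basisElt, ← toMatrix_basis_mul]
    funext j
    rfl
  rw [rebuild_apply, h, Finset.prod_eq_single i]
  · simp
  · intro j _ hj
    rw [Matrix.one_apply_ne hj.symm, zpow_zero]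
  · simp

/-- Both sides are homomorphisms on γ_5; they agree on the 33 commutators because `basisInv` inverts
their coordinate matrix, and on γ_8 because both are trivial there. -/
lemma rebuild_eq (w : Gam5) : rebuild w = (w : Gam5 ⧸ Gam8In) := by
  have h : spn (basis gbr (FreeGroup.of false) (FreeGroup.of true)) 8 ≤
      (rebuild.eqLocus (QuotientGroup.mk' Gam8In)).map (gam (FreeGroup Bool) 5).subtype := by
    refine sup_le ((Subgroup.closure_le _).2 ?_) ?_
    · intro x hx
      rw [Set.mem_ofPred_eq, basis_eq_map, List.mem_map] at hx
      obtain ⟨L, hL, rfl⟩ := hx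
      obtain ⟨i, hi, rfl⟩ := List.mem_iff_getElem.1 hL
      exact ⟨basisElt ⟨i, hi⟩, rebuild_basisElt ⟨i, hi⟩, rfl⟩
    · intro x hx
      refine ⟨⟨x, gam_antitone (by norm_num) hx⟩, ?_, rfl⟩
      have h0 : cvec x = 0 := by
        funext j
        exact cvec_eq_zero hx j (by have := lyndon_length j; omega)
      have e1 : ((⟨x, gam_antitone (by norm_num) hx⟩ : Gam5) : Gam5 ⧸ Gam8In) = 1 :=
        (QuotientGroup.eq_one_iff _).2 hx
      exact (rebuild_eq_one h0).trans e1.symm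
  obtain ⟨z, hz, e⟩ := h (gam_five_le_spn_basis closure_generators w.2)
  obtain rfl : z = w := Subtype.ext e
  exact hz

/-- The coordinates determine an element of `gam 5` modulo `gam 8`. -/
lemma mem_gam_eight_of_cvec_eq_zero {w : FreeGroup Bool} (hw : w ∈ gam (FreeGroup Bool) 5)
    (h : cvec w = 0) : w ∈ gam (FreeGroup Bool) 8 := by
  have h1 := rebuild_eq ⟨w, hw⟩
  rw [rebuild_eq_one h, eq_comm] at h1
  exact (QuotientGroup.eq_one_iff (N := Gam8In) ⟨w, hw⟩).1 h1

lemma engelComm_mem_gam (x y : FreeGroup Bool) (n : ℕ) :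
    EngelGroup.engelComm x y n ∈ gam (FreeGroup Bool) (n + 1) := by
  induction n with
  | zero => exact mem_gam_one x
  | succ n ih =>
    have : EngelGroup.engelComm x y (n + 1) = ⁅(EngelGroup.engelComm x y n)⁻¹, y⁻¹⁆ := by
      rw [commutatorElement_def, inv_inv, inv_inv]; rfl
    rw [this]
    exact comm_mem_gam_succ (inv_mem ih) (by omega) _

lemma relatorWords_mem {L : List (Bool × Bool)} (hL : L ∈ relatorWords) :
    ∃ g h : FreeGroup Bool,
      FreeGroup.mk L = h⁻¹ * EngelGroup.engelComm (FreeGroup.of false) g 4 * h := by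
  simp only [relatorWords, List.mem_append, List.mem_flatMap, List.mem_map] at hL
  rcases hL with ⟨g, _, h, _, rfl⟩ | ⟨g, _, rfl⟩
  · exact ⟨FreeGroup.mk g, FreeGroup.mk h, by rw [mk_conjWord, mk_engelWord]; rfl⟩
  · exact ⟨FreeGroup.mk g, 1, by rw [mk_engelWord, inv_one, one_mul, mul_one]; rfl⟩

section Certificate

variable {R : Subgroup (FreeGroup Bool)} [R.Normal]

lemma exists_relator (hR : ∀ g, EngelGroup.engelComm (FreeGroup.of false) g 4 ∈ R) :
    ∃ f : Fin 33 → Gam5, (∀ j, (f j : FreeGroup Bool) ∈ R) ∧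
      ∀ j : Fin 33, (j : ℕ) < 30 → cvec (f j) = toMatrix 33 (relatorRows ++ complementRows) j := by
  have key : ∀ j : Fin 33, ∃ x : Gam5, (x : FreeGroup Bool) ∈ R ∧
      ((j : ℕ) < 30 → cvec x = toMatrix 33 (relatorRows ++ complementRows) j) := by
    intro j
    by_cases hj : (j : ℕ) < 30
    · have hj' : (j : ℕ) < relatorWords.length := hj
      obtain ⟨g, h, e⟩ := relatorWords_mem (List.getElem_mem hj')
      have h5 : FreeGroup.mk relatorWords[(j : ℕ)] ∈ gam (FreeGroup Bool) 5 := by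
        rw [e]
        simpa using (gam_normal 5).conj_mem _ (engelComm_mem_gam (FreeGroup.of false) g 4) h⁻¹
      have hr : FreeGroup.mk relatorWords[(j : ℕ)] ∈ R := by
        rw [e]
        simpa using (inferInstance : R.Normal).conj_mem _ (hR g) h⁻¹
      refine ⟨⟨_, h5⟩, hr, fun _ => ?_⟩
      funext i
      rw [cvec_eq_of_map_eq (map_coords_eq_of_check check_relators) hj' i]
      have hl : (j : ℕ) < relatorRows.length := hj
      rw [toMatrix, Matrix.of_apply, List.getD_append _ _ _ _ hl]
    -- The three complementary rows come from no relator; the filler 1 will carry exponent 0.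
    · exact ⟨1, one_mem R, fun h => absurd h hj⟩
  choose f hf using key
  exact ⟨f, fun j => (hf j).1, fun j => (hf j).2⟩

lemma toMatrix_relatorInv_mul :
    toMatrix 33 relatorInv * toMatrix 33 (relatorRows ++ complementRows) = (1800 : ℤ) • 1 := by
  rw [← toMatrix_mulRows 33 _ _ (by decide), relator_inv_mul, toMatrix_scalarRows]

/-- The linear functionals vanishing on all Engel commutators of the first generator. -/
structure Balanced (v : Series) : Prop where
  first : 7 * v [false, false, true, true, true] + 3 * v [false, true, false, true, true] = 0
  second : 3 * v [false, false, true, false, true] + 3 * v [false, true, false, true, true] -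
    14 * v [false, false, false, true, true, true] -
    6 * v [false, false, true, false, true, true] = 0
  third : 7 * v [false, false, false, true, true] - 3 * v [false, true, false, true, true] +
    14 * v [false, false, false, true, true, true] +
    6 * v [false, false, true, false, true, true] = 0

/-- The last three columns of `relatorInv` are the functionals, so balanced coordinates do not use
the complementary rows. -/
lemma Balanced.vecMul_eq_zero {w : FreeGroup Bool} (h : Balanced (coef w)) (j : Fin 33)
    (hj : ¬ (j : ℕ) < 30) : Matrix.vecMul (cvec w) (toMatrix 33 relatorInv) j = 0 := by
  have h1 : ∀ i : Fin 33, toMatrix 33 relatorInv i 30 =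
      (if i = 3 then 7 else 0) + (if i = 4 then 3 else 0) := by decide +kernel
  have h2 : ∀ i : Fin 33, toMatrix 33 relatorInv i 31 =
      (if i = 2 then 3 else 0) + (if i = 4 then 3 else 0) + (if i = 9 then -14 else 0) +
        (if i = 10 then -6 else 0) := by decide +kernel
  have h3 : ∀ i : Fin 33, toMatrix 33 relatorInv i 32 =
      (if i = 1 then 7 else 0) + (if i = 4 then -3 else 0) + (if i = 9 then 14 else 0) +
        (if i = 10 then 6 else 0) := by decide +kernel
  have hj' : j = 30 ∨ j = 31 ∨ j = 32 := by
    have := j.2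
    simp only [Fin.ext_iff]
    have e1 : ((30 : Fin 33) : ℕ) = 30 := rfl
    have e2 : ((31 : Fin 33) : ℕ) = 31 := rfl
    have e3 : ((32 : Fin 33) : ℕ) = 32 := rfl
    omega
  have c1 : cvec w 1 = coef w [false, false, false, true, true] := rfl
  have c2 : cvec w 2 = coef w [false, false, true, false, true] := rfl
  have c3 : cvec w 3 = coef w [false, false, true, true, true] := rfl
  have c4 : cvec w 4 = coef w [false, true, false, true, true] := rfl
  have c9 : cvec w 9 = coef w [false, false, false, true, true, true] := rfl
  have c10 : cvec w 10 = coef w [false, false, true, false, true, true] := rfl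
  obtain ⟨b1, b2, b3⟩ := h
  rcases hj' with rfl | rfl | rfl
  · simp only [Matrix.vecMul, dotProduct, h1, mul_add, Finset.sum_add_distrib, mul_ite, mul_zero,
      Finset.sum_ite_eq', Finset.mem_univ, if_true, c3, c4]
    linarith
  · simp only [Matrix.vecMul, dotProduct, h2, mul_add, Finset.sum_add_distrib, mul_ite, mul_zero,
      Finset.sum_ite_eq', Finset.mem_univ, if_true, c2, c4, c9, c10]
    linarith
  · simp only [Matrix.vecMul, dotProduct, h3, mul_add, Finset.sum_add_distrib, mul_ite, mul_zero,
      Finset.sum_ite_eq', Finset.mem_univ, if_true, c1, c4, c9, c10]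
    linarith

/-- An element of `gam 5` with balanced coefficients has its power of exponent `1800` in the
normal closure of the Engel commutators of the first generator, modulo `gam 8`. -/
theorem exists_mem_pow_mul_inv_mem (hR : ∀ g, EngelGroup.engelComm (FreeGroup.of false) g 4 ∈ R)
    {w : FreeGroup Bool} (hw : w ∈ gam (FreeGroup Bool) 5) (hb : Balanced (coef w)) :
    ∃ r ∈ R, w ^ 1800 * r⁻¹ ∈ gam (FreeGroup Bool) 8 := by
  obtain ⟨f, hfR, hf⟩ := exists_relator hR
  -- The exponents of the relators. Multiplying c by the coordinate matrix gives 1800 times the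
  -- coordinates of w, so w^1800 and r have equal coordinates.
  set c := Matrix.vecMul (cvec w) (toMatrix 33 relatorInv) with hc
  set r : Gam5 := (List.ofFn fun j => f j ^ c j).prod with hr
  refine ⟨r, ?_, ?_⟩
  · rw [hr, ← Subgroup.coe_subtype, map_list_prod]
    refine list_prod_mem fun x hx => ?_
    simp only [List.map_ofFn, List.mem_ofFn, Function.comp] at hx
    obtain ⟨j, rfl⟩ := hx
    rw [map_zpow]
    exact zpow_mem (hfR j) _
  · refine mem_gam_eight_of_cvec_eq_zero (mul_mem (pow_mem hw _) (inv_mem r.2)) ?_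
    have h1 : ∀ n : ℕ, Multiplicative.toAdd (cvecHom ((⟨w, hw⟩ : Gam5) ^ n * r⁻¹)) =
        cvec (w ^ n * (r : FreeGroup Bool)⁻¹) := fun n => rfl
    have h2 : Multiplicative.toAdd (cvecHom r) = ∑ j, c j • cvec (f j) := by
      rw [hr, map_list_prod, List.map_ofFn, List.prod_ofFn, toAdd_prod]
      refine Finset.sum_congr rfl fun j _ => ?_
      rw [Function.comp_apply, map_zpow, toAdd_zpow]
      rfl
    have h3 : ∑ j, c j • cvec (f j) =
        Matrix.vecMul c (toMatrix 33 (relatorRows ++ complementRows)) := by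
      rw [Matrix.vecMul_eq_sum]
      refine Finset.sum_congr rfl fun j _ => ?_
      by_cases hj : (j : ℕ) < 30
      · rw [hf j hj]
      · rw [hc, hb.vecMul_eq_zero j hj, zero_smul, zero_smul]
    rw [← h1, map_mul, map_inv, map_pow, toAdd_mul, toAdd_inv, toAdd_pow, h2, h3, hc,
      Matrix.vecMul_vecMul, toMatrix_relatorInv_mul, Matrix.vecMul_smul, Matrix.vecMul_one]
    have h4 : Multiplicative.toAdd (cvecHom ⟨w, hw⟩) = cvec w := rfl
    rw [h4, ← natCast_zsmul, Nat.cast_ofNat, add_neg_cancel]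

end Certificate

end MagnusRep

/-! ### Engel commutators satisfy the three linear relations -/

namespace MagnusRep

open LowerCentral

lemma magnus_of_inv (x : Bool) : magnus (FreeGroup.of x)⁻¹ = (letter x).symm := by
  rw [map_inv, magnus_of]; rfl

/-- The shuffle relations in degree two. -/
lemma coef_shuffle (w : FreeGroup Bool) (x y : Bool) :
    coef w [x] * coef w [y] =
      coef w [x, y] + coef w [y, x] + if x = y then coef w [x] else 0 := by
  -- The diagonal term appears because a generator maps to 1 + x, not to an exponential. The
  -- identity is checked on generators and their inverses and is preserved by products.
  induction w using FreeGroup.induction_on generalizing x y with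
  | C1 =>
    have h : ∀ u : List Bool, coef 1 u = if u = [] then 1 else 0 := fun u => by
      simp [coef, Pi.single_apply]
    simp [h]
  | of z =>
    have h : ∀ u : List Bool, coef (FreeGroup.of z) u = letterFun z (Pi.single [] 1) u := fun u => by
      rw [coef, magnus_of]; rfl
    simp only [h, letterFun, Pi.single_apply]
    cases x <;> cases y <;> cases z <;> simp
  | inv_of z _ =>
    have h : ∀ u : List Bool, coef (FreeGroup.of z)⁻¹ u = letterInv z (Pi.single [] 1) u := fun u => by
      rw [coef, magnus_of_inv]; rfl
    simp only [h, letterInv, Pi.single_apply]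
    cases x <;> cases y <;> cases z <;> simp
  | mul w z hw hz =>
    have h1 : ∀ x, coef (w * z) [x] = coef w [x] + coef z [x] := fun x => by
      simp [coef_mul, conv, coef_nil]; ring
    have h2 : ∀ x y, coef (w * z) [x, y] =
        coef w [x, y] + coef w [x] * coef z [y] + coef z [x, y] := fun x y => by
      simp [coef_mul, conv, coef_nil]; ring
    have a1 := hw x y
    have a2 := hz x y
    rw [h1, h1, h2, h2]
    split_ifs at a1 a2 ⊢ <;> linear_combination a1 + a2

/-- From gw·[w, g] = wg: comparing coefficients yields those of the commutator recursively, without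
inverse series. -/
lemma conv_comm (w g : FreeGroup Bool) :
    conv (conv (coef g) (coef w)) (coef (EngelGroup.comm w g)) = conv (coef w) (coef g) := by
  rw [← coef_mul, ← coef_mul, ← coef_mul]
  congr 1
  rw [EngelGroup.comm]
  group

/-- The relations satisfied by the coefficients `Z` of the commutator of an element of weight `n`
with coefficients `W` and of an element with coefficients `G`. -/
structure CommStep (n : ℕ) (W G Z : Series) : Prop where
  hW : W [] = 1
  hG : G [] = 1
  hZ : Z [] = 1
  eq : conv (conv G W) Z = conv W G
  hWz : ∀ u : List Bool, u ≠ [] → u.length < n → W u = 0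
  hZz : ∀ u : List Bool, u ≠ [] → u.length < n + 1 → Z u = 0

lemma engel_commStep (x g : FreeGroup Bool) (n : ℕ) :
    CommStep (n + 1) (coef (EngelGroup.engelComm x g n)) (coef g)
      (coef (EngelGroup.engelComm x g (n + 1))) where
  hW := coef_nil _
  hG := coef_nil _
  hZ := coef_nil _
  eq := conv_comm _ _
  hWz _ h0 h := coef_eq_zero (gam_le_filt _ (engelComm_mem_gam x g n)) h h0
  hZz _ h0 h := coef_eq_zero (gam_le_filt _ (engelComm_mem_gam x g (n + 1))) h h0

namespace CommStep

variable {W G Z : Series}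

/-- This and its companions solve gw·[w, g] = wg in the two lowest degrees, n + 1 and n + 2, where W
starts in degree n. Chained for n = 1, …, 4, they express the coefficients of [x, ₄g] of lengths 5
and 6 through those of x and g of lengths 1 and 2. -/
lemma one_low (h : CommStep 1 W G Z) (p q : Bool) : Z [p, q] = W [p] * G [q] - G [p] * W [q] := by
  have e := congrFun h.eq [p, q]
  simp [conv, h.hW, h.hG, h.hZ, h.hZz] at e
  linear_combination e

lemma one_high (h : CommStep 1 W G Z) (p q r : Bool) : Z [p, q, r] =
    W [p] * G [q, r] + W [p, q] * G [r] - G [p] * W [q, r] - G [p, q] * W [r] -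
      (G [p] + W [p]) * Z [q, r] := by
  have e := congrFun h.eq [p, q, r]
  simp [conv, h.hW, h.hG, h.hZ, h.hZz] at e
  linear_combination e

lemma two_low (h : CommStep 2 W G Z) (p q r : Bool) :
    Z [p, q, r] = W [p, q] * G [r] - G [p] * W [q, r] := by
  have e := congrFun h.eq [p, q, r]
  simp [conv, h.hW, h.hG, h.hZ, h.hWz, h.hZz] at e
  linear_combination e

lemma two_high (h : CommStep 2 W G Z) (p q r s : Bool) : Z [p, q, r, s] =
    W [p, q] * G [r, s] + W [p, q, r] * G [s] -
      G [p] * W [q, r, s] - G [p, q] * W [r, s] - G [p] * Z [q, r, s] := by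
  have e := congrFun h.eq [p, q, r, s]
  simp [conv, h.hW, h.hG, h.hZ, h.hWz, h.hZz] at e
  linear_combination e

lemma three_low (h : CommStep 3 W G Z) (p q r s : Bool) :
    Z [p, q, r, s] = W [p, q, r] * G [s] - G [p] * W [q, r, s] := by
  have e := congrFun h.eq [p, q, r, s]
  simp [conv, h.hW, h.hG, h.hZ, h.hWz, h.hZz] at e
  linear_combination e

lemma three_high (h : CommStep 3 W G Z) (p q r s t : Bool) : Z [p, q, r, s, t] =
    W [p, q, r] * G [s, t] + W [p, q, r, s] * G [t] -
      G [p] * W [q, r, s, t] - G [p, q] * W [r, s, t] - G [p] * Z [q, r, s, t] := by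
  have e := congrFun h.eq [p, q, r, s, t]
  simp [conv, h.hW, h.hG, h.hZ, h.hWz, h.hZz] at e
  linear_combination e

lemma four_low (h : CommStep 4 W G Z) (p q r s t : Bool) :
    Z [p, q, r, s, t] = W [p, q, r, s] * G [t] - G [p] * W [q, r, s, t] := by
  have e := congrFun h.eq [p, q, r, s, t]
  simp [conv, h.hW, h.hG, h.hZ, h.hWz, h.hZz] at e
  linear_combination e

lemma four_high (h : CommStep 4 W G Z) (p q r s t u : Bool) : Z [p, q, r, s, t, u] =
    W [p, q, r, s] * G [t, u] + W [p, q, r, s, t] * G [u] -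
      G [p] * W [q, r, s, t, u] - G [p, q] * W [r, s, t, u] - G [p] * Z [q, r, s, t, u] := by
  have e := congrFun h.eq [p, q, r, s, t, u]
  simp [conv, h.hW, h.hG, h.hZ, h.hWz, h.hZz] at e
  linear_combination e

end CommStep

/-- Engel commutators in the free group have balanced coefficients. -/
theorem balanced_engelComm (x g : FreeGroup Bool) :
    Balanced (coef (EngelGroup.engelComm x g 4)) := by
  have h1 := engel_commStep x g 0
  have h2 := engel_commStep x g 1
  have h3 := engel_commStep x g 2
  have h4 := engel_commStep x g 3
  have g1 := coef_shuffle g false false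
  have g2 := coef_shuffle g false true
  have g3 := coef_shuffle g true true
  have x1 := coef_shuffle x false false
  have x2 := coef_shuffle x false true
  have x3 := coef_shuffle x true true
  simp only [if_true, reduceCtorEq, if_false, add_zero] at g1 g2 g3 x1 x2 x3
  have e : EngelGroup.engelComm x g 0 = x := rfl
  constructor
  all_goals
    simp only [h4.four_low, h4.four_high, h3.three_low, h3.three_high, h2.two_low, h2.two_high,
      h1.one_low, h1.one_high, e]
    generalize coef x [false] = i at *
    generalize coef x [true] = j at *
    generalize coef g [false] = k at *
    generalize coef g [true] = l at *
    generalize coef x [false, false] = xaa at *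
    generalize coef x [false, true] = xab at *
    generalize coef x [true, false] = xba at *
    generalize coef x [true, true] = xbb at *
    generalize coef g [false, false] = gaa at *
    generalize coef g [false, true] = gab at *
    generalize coef g [true, false] = gba at *
    generalize coef g [true, true] = gbb at *
    clear h1 h2 h3 h4 e
    obtain rfl : gba = k * l - gab := by linarith
    obtain rfl : xba = i * j - xab := by linarith
    -- The shuffle relations leave the linear coefficients and one mixed quadratic coefficient for
    -- each of x and g as free variables. Halving the diagonal relations requires ℚ; the claim is
    -- then a polynomial identity.
    have y1 : (xaa : ℚ) = (i * i - i) / 2 := by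
      have : (i * i : ℚ) = xaa + xaa + i := by exact_mod_cast x1
      linarith
    have y3 : (xbb : ℚ) = (j * j - j) / 2 := by
      have : (j * j : ℚ) = xbb + xbb + j := by exact_mod_cast x3
      linarith
    have z1 : (gaa : ℚ) = (k * k - k) / 2 := by
      have : (k * k : ℚ) = gaa + gaa + k := by exact_mod_cast g1
      linarith
    have z3 : (gbb : ℚ) = (l * l - l) / 2 := by
      have : (l * l : ℚ) = gbb + gbb + l := by exact_mod_cast g3
      linarith
    clear x1 x2 x3 g1 g2 g3
    rw [← Int.cast_inj (α := ℚ)]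
    push_cast
    -- The first functional lives in degree five, where only linear coefficients occur and there is
    -- nothing to rewrite.
    try simp only [y1, y3, z1, z3]
    ring

end MagnusRep

/-! ### Powers annihilating lower central factors -/

namespace LowerCentral

variable {H K : Type*} [Group H] [Group K]

lemma map_gam {f : H →* K} (hf : Function.Surjective f) : ∀ n, (gam H n).map f = gam K n
  | 0 => Subgroup.map_top_of_surjective f hf
  | 1 => Subgroup.map_top_of_surjective f hf
  | n + 2 => by
    show Subgroup.map f ⁅gam H (n + 1), ⊤⁆ = ⁅gam K (n + 1), ⊤⁆
    rw [Subgroup.map_commutator, map_gam hf (n + 1), Subgroup.map_top_of_surjective f hf]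

lemma red_comm_pow {i j n : ℕ} {x y : H} (hx : x ∈ gam H i) (hy : y ∈ gam H j) (hi : 1 ≤ i)
    (h : n ≤ i + j + 1) (k : ℕ) : red n ⁅x ^ k, y⁆ = red n ⁅x, y⁆ ^ k := by
  induction k with
  | zero => simp
  | succ k ih => rw [pow_succ, pow_succ, red_comm_mul_left (pow_mem hx k) hx hy hi h, ih]

/-- If `k` annihilates a lower central factor then it annihilates the next one. -/
lemma pow_mem_gam_succ {n k : ℕ} (hn : 1 ≤ n) (h : ∀ x ∈ gam H n, x ^ k ∈ gam H (n + 1)) :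
    ∀ x ∈ gam H (n + 1), x ^ k ∈ gam H (n + 2) := by
  intro x hx
  obtain ⟨m, rfl⟩ : ∃ m, n = m + 1 := ⟨n - 1, by omega⟩
  suffices x ∈ gam H (m + 1 + 1) ∧ red (m + 1 + 2) x ^ k = 1 by
    rw [← red_eq_one, map_pow]; exact this.2
  have hx' : x ∈ Subgroup.closure {z | ∃ p ∈ gam H (m + 1), ∃ q ∈ (⊤ : Subgroup H), ⁅p, q⁆ = z} := hx
  induction hx' using Subgroup.closure_induction with
  | mem z hz =>
    obtain ⟨p, hp, q, -, rfl⟩ := hz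
    refine ⟨comm_mem_gam_succ hp (by omega) q, ?_⟩
    -- Modulo γ_{n+2}, [p, q]^k = [p^k, q] with p^k in γ_{n+1}. Generators suffice since
    -- γ_{n+1}/γ_{n+2} is abelian.
    rw [← red_comm_pow hp (mem_gam_one q) (by omega) (by omega), red_eq_one]
    exact comm_mem_gam_succ (h p hp) (by omega) q
  | one => exact ⟨one_mem _, by rw [map_one, one_pow]⟩
  | mul y z hy hz ihy ihz =>
    have hy' := ihy hy
    have hz' := ihz hz
    refine ⟨mul_mem hy'.1 hz'.1, ?_⟩
    rw [map_mul, (red_commute hy'.1 hz'.1 (by omega)).mul_pow, hy'.2, hz'.2, one_mul]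
  | inv y hy ihy =>
    have hy' := ihy hy
    exact ⟨inv_mem hy'.1, by rw [map_inv, inv_pow, hy'.2, inv_one]⟩

/-- If `k` annihilates a lower central factor of a nilpotent group in which no nontrivial element
has trivial `k`-th power, then this term of the lower central series is trivial. -/
lemma gam_eq_bot_of_pow_mem [Group.IsNilpotent H] {n k : ℕ} (hn : 1 ≤ n)
    (h : ∀ x ∈ gam H n, x ^ k ∈ gam H (n + 1)) (hk : ∀ x : H, x ^ k = 1 → x = 1) :
    gam H n = ⊥ := by
  have hall : ∀ m, ∀ x ∈ gam H (n + m), x ^ k ∈ gam H (n + m + 1) := by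
    intro m
    induction m with
    | zero => exact h
    | succ m ih => exact pow_mem_gam_succ (n := n + m) (by omega) ih
  -- If a term is trivial, elements of the preceding one have trivial k-th power, hence are trivial;
  -- nilpotency provides the starting point of this descent.
  have hdown : ∀ m, gam H (n + m) = ⊥ → gam H n = ⊥ := by
    intro m
    induction m with
    | zero => exact id
    | succ m ih =>
      intro hm
      refine ih ((Subgroup.eq_bot_iff_forall _).2 fun x hx => hk x ?_)
      have := hall m x hx
      rwa [add_assoc, hm, Subgroup.mem_bot] at this
  obtain ⟨m, hm⟩ := Subgroup.nilpotent_iff_lowerCentralSeries.1 (inferInstance : Group.IsNilpotent H)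
  rw [← gam_succ_eq] at hm
  refine hdown (m + 1) (le_bot_iff.1 (le_trans (gam_antitone ?_) hm.le))
  omega

end LowerCentral

/-! ### Transfer to the group G -/

namespace EngelGroup

open LowerCentral MagnusRep

lemma map_engelComm {H K : Type*} [Group H] [Group K] (f : H →* K) (x y : H) (n : ℕ) :
    f (engelComm x y n) = engelComm (f x) (f y) n := by
  induction n with
  | zero => rfl
  | succ n ih => simp only [engelComm, comm, map_mul, map_inv, ih]

/-- As 1800 = 2³·3²·5², a nontrivial x would have a power of order exactly 2, 3 or 5. -/
lemma eq_one_of_pow_eq_one {G : Type*} [Group G] (h2 : ∀ g : G, orderOf g ≠ 2)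
    (h3 : ∀ g : G, orderOf g ≠ 3) (h5 : ∀ g : G, orderOf g ≠ 5) {x : G} (hx : x ^ 1800 = 1) :
    x = 1 := by
  by_contra hne
  have hd : orderOf x ∣ 1800 := orderOf_dvd_of_pow_eq_one hx
  have h1 : orderOf x ≠ 1 := fun h => hne (orderOf_eq_one_iff.1 h)
  obtain ⟨p, hp, hpd⟩ := Nat.exists_prime_and_dvd h1
  have h0 : orderOf x ≠ 0 := fun h => by rw [h] at hd; norm_num at hd
  have ho := orderOf_pow_orderOf_div h0 hpd
  have hp' : p ∣ 2 ^ 3 * 3 ^ 2 * 5 ^ 2 := hpd.trans hd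
  rcases (Nat.Prime.dvd_mul hp).1 hp' with h | h
  · rcases (Nat.Prime.dvd_mul hp).1 h with h | h
    · rw [(Nat.prime_dvd_prime_iff_eq hp Nat.prime_two).1 (hp.dvd_of_dvd_pow h)] at ho
      exact h2 _ ho
    · rw [(Nat.prime_dvd_prime_iff_eq hp Nat.prime_three).1 (hp.dvd_of_dvd_pow h)] at ho
      exact h3 _ ho
  · rw [(Nat.prime_dvd_prime_iff_eq hp Nat.prime_five).1 (hp.dvd_of_dvd_pow h)] at ho
    exact h5 _ ho

section Presentation

variable {G : Type*} [Group G] {a b : G}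

/-- The homomorphism from the free group of rank two with the given images of the generators. -/
def present (a b : G) : FreeGroup Bool →* G := FreeGroup.lift fun x => cond x b a

lemma present_surjective (hgen : Subgroup.closure {a, b} = ⊤) :
    Function.Surjective (present a b) := by
  rw [← MonoidHom.range_eq_top, ← top_le_iff, ← hgen, Subgroup.closure_le]
  rintro x (rfl | rfl)
  · exact ⟨FreeGroup.of false, by simp [present]⟩
  · exact ⟨FreeGroup.of true, by simp [present]⟩

/-- The image of an element of `gam 5` with balanced coefficients. -/
lemma present_pow_mem (hgen : Subgroup.closure {a, b} = ⊤) (ha : IsRightEngel 4 a)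
    {w : FreeGroup Bool} (hw : w ∈ gam (FreeGroup Bool) 5) (hb : Balanced (coef w)) :
    present a b w ^ 1800 ∈ gam G 8 := by
  have hR : ∀ g, engelComm (FreeGroup.of false) g 4 ∈ (present a b).ker := fun g => by
    rw [MonoidHom.mem_ker, map_engelComm, show present a b (FreeGroup.of false) = a by simp [present]]
    exact ha _
  obtain ⟨r, hr, h⟩ := exists_mem_pow_mul_inv_mem hR hw hb
  have := Subgroup.mem_map_of_mem (present a b) h
  rwa [map_gam (present_surjective hgen), map_mul, map_inv, MonoidHom.mem_ker.1 hr, inv_one, mul_one,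
    map_pow] at this

/-- The functionals only see words of length 5 and 6, where the coefficients of elements of γ_7
vanish. -/
lemma balanced_of_mem_gam_seven {w : FreeGroup Bool} (hw : w ∈ gam (FreeGroup Bool) 7) :
    Balanced (coef w) := by
  have h : ∀ u : List Bool, u ≠ [] → u.length < 7 → coef w u = 0 :=
    fun u h0 hu => coef_eq_zero (gam_le_filt 7 hw) hu h0
  constructor <;> simp [h]

end Presentation

end EngelGroup

theorem mainTheorem3 {G : Type*} [Group G] (hG : Group.IsNilpotent G)
    (a b : G) (hgen : Subgroup.closure {a, b} = ⊤)
    (ha : EngelGroup.IsRightEngel 4 a)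
    (h2 : ∀ g : G, orderOf g ≠ 2) (h3 : ∀ g : G, orderOf g ≠ 3) (h5 : ∀ g : G, orderOf g ≠ 5) :
    EngelGroup.IsEngel 4 G ∧ Group.nilpotencyClass G ≤ 6 := by
  have hsurj := EngelGroup.present_surjective hgen
  have h7 : LowerCentral.gam G 7 = ⊥ := by
    refine LowerCentral.gam_eq_bot_of_pow_mem (k := 1800) (by norm_num) (fun x hx => ?_)
      fun x => EngelGroup.eq_one_of_pow_eq_one h2 h3 h5
    rw [← LowerCentral.map_gam hsurj] at hx
    obtain ⟨w, hw, rfl⟩ := hx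
    exact EngelGroup.present_pow_mem hgen ha (LowerCentral.gam_antitone (by norm_num) hw)
      (EngelGroup.balanced_of_mem_gam_seven hw)
  refine ⟨fun x g => ?_, ?_⟩
  · obtain ⟨x, rfl⟩ := hsurj x
    obtain ⟨g, rfl⟩ := hsurj g
    rw [← EngelGroup.map_engelComm]
    refine EngelGroup.eq_one_of_pow_eq_one h2 h3 h5 ?_
    -- The 1800-th power of [x, ₄g] lies in γ_8(G), which is contained in the trivial group γ_7(G).
    have h := LowerCentral.gam_antitone (by norm_num : 7 ≤ 8) (EngelGroup.present_pow_mem hgen ha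
      (MagnusRep.engelComm_mem_gam x g 4) (MagnusRep.balanced_engelComm x g))
    rwa [h7, Subgroup.mem_bot] at h
  · rw [← Subgroup.lowerCentralSeries_eq_bot_iff_nilpotencyClass_le, ← LowerCentral.gam_succ_eq]
    exact h7
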